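/- Theorem. Let $m\ge 5$, $1<r<m-1$ and $\gcd(r,m)=1$; put $q=2^m$, $F=\mathbb F_{q}$, $K=\mathbb F_{q^2}$. Write $\bar x=x^q$ for $x\in K$; let $tr$ and $Tr$ be the absolute traces of $F$ and $K$, let $\langle x,y\rangle=x\bar y+\bar x y\in F$, and let $S=\{u\in K: u\bar u=1\}$. Let $a,i\in K$ with $a+\bar a=1$ and $i+\bar i=1$. A Niho bent function is a bent function $f:K\to\mathbb F_2$ that is $\mathbb F_2$-linear on each $uF$, $u\in S$; then there is a unique $g:S\to F$, the $g$-function of $f$, with $f(\lambda u)=tr(\lambda g(u))$ for all $\lambda\in F$, $u\in S$. In the model of $PG(2,q)$ whose points are the classes $(x:z)$ of the nonzero $(x,z)\in K\times F$ modulo $F^*$, the points $(u:g(u))$, $u\in S$, form an oval with nucleus $(0:1)$. We say that $f$ is associated with a hyperoval $\mathcal H$ of $PG(2,q)$ if the hyperoval $\{(u:g(u)):u\in S\}\cup\{(0:1)\}$ is projectively equivalent to $\mathcal H$ (under bijective semilinear maps). Two functions $f,f':K\to\mathbb F_2$ are equivalent if $f'=f\circ L+\ell$ with $L$ an $\mathbb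 F_2$-affine permutation of $K$ and $\ell:K\to\mathbb F_2$ an affine function. For $s\in\{r,m-r\}$ put $$f_s(x)=Tr\Big(a x^{2^m+1}+\sum_{j=1}^{2^{s-1}-1}x^{d_j}\Big),\qquad 2^s d_j\equiv(2^m-1)j+2^s \pmod{2^{2m}-1},$$ $$g_s(u)=\frac{u\,u^{2^{m-s}}+\bar u\,\bar u^{2^{m-s}}}{u^{2^{m-s}}+\bar u^{2^{m-s}}}\quad(u\in S,\ u\ne1),\qquad g_s(1)=1 .$$ Then there are exactly three equivalence classes of Niho bent functions associated with the irregular translation hyperoval $$\mathcal D(t^{2^r})=\{(t:t^{2^r}:1):t\in F\}\cup\{(0:1:0),(1:0:0)\}.$$ Representatives, which are themselves Niho bent functions associated with $\mathcal D(t^{2^r})$, are $f_r$, $f_{m-r}$ and $$f(x)=tr\big(\langle i,x\rangle^{e}\,\langle 1,x\rangle^{q-e}\big),$$ where $e\in\{1,\dots,q-2\}$ is the inverse of $1-2^r$ modulo $q-1$. Their $g$-functions are, respectively, $g_r(u)$, $g_{m-r}(u)$ and $\langle i,u\rangle^{e}\langle 1,u\rangle^{q-e}$. -/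

import Mathlib

open scoped LinearAlgebra.Projectivization

namespace Niho

section Field

variable (F : Type*) {K : Type*} [Field F] [Fintype F] [Field K] [Algebra F K]

/-- Conjugation `x ↦ x ^ q` of `K` over `F`, where `q = |F|`. -/
def conj (x : K) : K := x ^ Fintype.card F

/-- The form `⟨x, y⟩ = T(x * conj y)` on `K`, with values in `F`, where `T` is the trace of `K / F`. -/
noncomputable def form (x y : K) : F := Algebra.trace F K (x * conj F y)

variable (K) in
/-- The unit circle: the elements of `K` of norm `1` over `F`. -/
def unitCircle : Set K := {u | u * conj F u = 1}

end Field

theorem unitCircle_ne_zero (F : Type*) {K : Type*} [Fintype F] [Field K] (u : unitCircle F K) :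
    (u : K) ≠ 0 := by
  intro h
  have := u.2
  simp [unitCircle, h] at this

section Boolean

variable (F : Type*) {K : Type*} [Field F] [Fintype F] [Field K] [Fintype K] [Algebra F K]
  [Algebra (ZMod 2) F] [Algebra (ZMod 2) K]

/-- The Walsh transform of a Boolean function on `K`, for the scalar product
`b · x = tr ⟨b, x⟩`, where `tr` is the absolute trace of `F`. -/
noncomputable def walsh (f : K → ZMod 2) (b : K) : ℤ :=
  ∑ x : K, (-1) ^ (f x + Algebra.trace (ZMod 2) F (form F b x)).val

/-- A Boolean function on `K` (of size `2 ^ n = q ^ 2`) is bent if its Walsh transform takes only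
the values `2 ^ (n / 2) = q` and `-q`. -/
def IsBent (f : K → ZMod 2) : Prop :=
  ∀ b : K, walsh F f b = (Fintype.card F : ℤ) ∨ walsh F f b = -(Fintype.card F : ℤ)

/-- A Niho bent function: a bent function on `K` that is `𝔽₂`-linear (that is, additive) on each
element `u F`, with `u` in the unit circle, of the Desarguesian spread. -/
def IsNihoBent (f : K → ZMod 2) : Prop :=
  IsBent F f ∧ ∀ u ∈ unitCircle F K, ∀ a b : F, f ((a + b) • u) = f (a • u) + f (b • u)

/-- `g` is the function on the unit circle that corresponds to `f`: `f (a u) = tr (a g(u))` for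
all `a` in `F` and all `u` in the unit circle. -/
def Corresponds (f : K → ZMod 2) (g : unitCircle F K → F) : Prop :=
  ∀ (u : unitCircle F K) (a : F), f (a • (u : K)) = Algebra.trace (ZMod 2) F (a * g u)

end Boolean

section EA

variable {K : Type*} [Field K] [Algebra (ZMod 2) K]

/-- Extended-affine equivalence: `f' = f ∘ L + l` with `L` an affine permutation of `K` and `l` an
affine function on `K`, both over `𝔽₂`. -/
def EAEquiv (f f' : K → ZMod 2) : Prop :=
  ∃ (L : K ≃ᵃ[ZMod 2] K) (l : K →ᵃ[ZMod 2] ZMod 2), ∀ x, f' x = f (L x) + l x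

variable (K) in
/-- Extended-affine equivalence as an equivalence relation on all Boolean functions on `K`. -/
def eaSetoid : Setoid (K → ZMod 2) where
  r := EAEquiv
  iseqv :=
    { refl := fun _ => ⟨AffineEquiv.refl _ _, 0, fun _ => by simp⟩
      symm := by
        rintro f f' ⟨L, l, h⟩
        refine ⟨L.symm, -(l.comp L.symm.toAffineMap), fun x => ?_⟩
        simp [h, add_assoc, CharTwo.add_self_eq_zero]
      trans := by
        rintro f f' f'' ⟨L, l, h⟩ ⟨L', l', h'⟩
        refine ⟨L'.trans L, l.comp L'.toAffineMap + l', fun x => ?_⟩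
        simp [h, h', add_assoc] }

end EA

section Geometry

/-- Projective equivalence of point sets in two projective spaces over `F`: some bijective
semilinear map (for some automorphism of `F`) carries one set to the other. -/
def ProjEquiv {F V W : Type*} [Field F] [AddCommGroup V] [Module F V] [AddCommGroup W] [Module F W]
    (A : Set (ℙ F V)) (B : Set (ℙ F W)) : Prop :=
  ∃ (σ : F ≃+* F) (φ : V →ₛₗ[(σ : F →+* F)] W) (hφ : Function.Bijective φ),
    Projectivization.map φ hφ.1 '' A = B

/-- The point set `{(t : h(t) : 1) | t ∈ F} ∪ {(0 : 1 : 0), (1 : 0 : 0)}` of `PG(2, q)`. -/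
def hyperovalD {F : Type*} [Field F] (h : F → F) : Set (ℙ F (Fin 3 → F)) :=
  Set.range (fun t => Projectivization.mk F ![t, h t, 1] (by simp)) ∪
    {Projectivization.mk F ![0, 1, 0] (by simp), Projectivization.mk F ![1, 0, 0] (by simp)}

/-- For a function `g` on the unit circle, the set of the points `u / g(u)` together with the
origin, in the model of `PG(2, q)` whose points are `(x : z)` with `x ∈ K`, `z ∈ F`; the affine
point `x` is `(x : 1)`. So `u / g(u)` is `(u : g(u))`, which is the point at infinity in the
direction `u` if `g(u) = 0`. -/
def hyperovalOfG (F : Type*) {K : Type*} [Field F] [Fintype F] [Field K] [Algebra F K]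
    (g : unitCircle F K → F) : Set (ℙ F (K × F)) :=
  Set.range (fun u : unitCircle F K =>
      Projectivization.mk F ((u : K), g u) (by simp [unitCircle_ne_zero F u])) ∪
    {Projectivization.mk F ((0 : K), (1 : F)) (by simp)}

/-- `f` is a Niho bent function associated with the hyperoval `H`: it is a Niho bent function, and
the oval `{u / g(u)}` that corresponds to `f`, with its nucleus, the origin, added, is
projectively equivalent to `H`. -/
def IsAssociated {F K : Type*} [Field F] [Fintype F] [Field K] [Fintype K] [Algebra F K]
    [Algebra (ZMod 2) F] [Algebra (ZMod 2) K] (H : Set (ℙ F (Fin 3 → F))) (f : K → ZMod 2) : Prop :=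
  IsNihoBent F f ∧ ∃ g : unitCircle F K → F, Corresponds F f g ∧ ProjEquiv H (hyperovalOfG F g)

end Geometry

section Representatives

/-- The Niho exponent `d_i`, with `2 ^ r * d_i ≡ (2 ^ m - 1) * i + 2 ^ r` modulo `2 ^ (2 m) - 1`
(see `nihoExp_spec`); note that `2 ^ (2 m - r)` is the inverse of `2 ^ r` for this modulus. -/
def nihoExp (m r i : ℕ) : ℕ :=
  (((2 ^ m - 1) * i + 2 ^ r) * 2 ^ (2 * m - r)) % (2 ^ (2 * m) - 1)

theorem nihoExp_spec (m r i : ℕ) (hr : r ≤ 2 * m) :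
    2 ^ r * nihoExp m r i ≡ (2 ^ m - 1) * i + 2 ^ r [MOD 2 ^ (2 * m) - 1] := by
  have h2 : 2 ^ r * 2 ^ (2 * m - r) ≡ 1 [MOD 2 ^ (2 * m) - 1] := by
    rw [← pow_add, Nat.add_sub_cancel' hr]
    exact (Nat.modEq_sub Nat.one_le_two_pow)
  calc 2 ^ r * nihoExp m r i
      ≡ 2 ^ r * (((2 ^ m - 1) * i + 2 ^ r) * 2 ^ (2 * m - r)) [MOD 2 ^ (2 * m) - 1] :=
        (Nat.mod_modEq _ _).mul_left _
    _ = ((2 ^ m - 1) * i + 2 ^ r) * (2 ^ r * 2 ^ (2 * m - r)) := by ring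
    _ ≡ ((2 ^ m - 1) * i + 2 ^ r) * 1 [MOD 2 ^ (2 * m) - 1] := h2.mul_left _
    _ = (2 ^ m - 1) * i + 2 ^ r := mul_one _

/-- The function `f_r(x) = Tr (a x ^ (2 ^ m + 1) + ∑_{i = 1}^{2 ^ (r - 1) - 1} x ^ d_i)`, where
`Tr` is the absolute trace of `K`. -/
noncomputable def fTrans {K : Type*} [Field K] [Algebra (ZMod 2) K] (m r : ℕ) (a x : K) : ZMod 2 :=
  Algebra.trace (ZMod 2) K
    (a * x ^ (2 ^ m + 1) + ∑ i ∈ Finset.Icc 1 (2 ^ (r - 1) - 1), x ^ nihoExp m r i)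

open Classical in
/-- The function `g_r` on the unit circle: with `k = 2 ^ (m - r)` and `v = conj u`,
`g_r(u) = (u u ^ k + v v ^ k) / (u ^ k + v ^ k)` for `u ≠ 1`, and `g_r(1) = 1`. The numerator and
the denominator are traces from `K` to `F`. -/
noncomputable def gTrans (F : Type*) {K : Type*} [Field F] [Fintype F] [Field K] [Algebra F K]
    (m r : ℕ) (u : unitCircle F K) : F :=
  if (u : K) = 1 then 1
  else Algebra.trace F K ((u : K) * (u : K) ^ 2 ^ (m - r)) /
    Algebra.trace F K ((u : K) ^ 2 ^ (m - r))

/-- The inverse of `1 - 2 ^ r` modulo `2 ^ m - 1`, as a natural number in `{0, …, 2 ^ m - 2}`. -/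
def invExp (m r : ℕ) : ℕ := ((1 - 2 ^ r : ZMod (2 ^ m - 1))⁻¹).val

theorem invExp_spec (m r : ℕ) (hrm : Nat.gcd r m = 1) :
    (1 - 2 ^ r : ZMod (2 ^ m - 1)) * (1 - 2 ^ r : ZMod (2 ^ m - 1))⁻¹ = 1 := by
  have h1 : Nat.Coprime (2 ^ r - 1) (2 ^ m - 1) := by
    simp [Nat.Coprime, Nat.pow_sub_one_gcd_pow_sub_one, hrm]
  have h2 : (1 - 2 ^ r : ZMod (2 ^ m - 1)) = -((2 ^ r - 1 : ℕ) : ZMod (2 ^ m - 1)) := by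
    rw [Nat.cast_sub Nat.one_le_two_pow]
    push_cast
    ring
  apply ZMod.mul_inv_of_unit
  rw [h2]
  exact ((ZMod.isUnit_iff_coprime _ _).2 h1).neg

/-- The map `x ↦ ⟨i, x⟩ ^ e ⟨1, x⟩ ^ (q - e)` from `K` to `F`, where `q = 2 ^ m` and `e` is the
inverse of `1 - 2 ^ r` modulo `q - 1`. -/
noncomputable def thirdMap (F : Type*) {K : Type*} [Field F] [Fintype F] [Field K] [Algebra F K]
    (m r : ℕ) (i x : K) : F :=
  form F i x ^ invExp m r * form F 1 x ^ (2 ^ m - invExp m r)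

end Representatives

end Niho

open scoped LinearAlgebra.Projectivization

set_option linter.unusedSectionVars false

/-! Write q = 2^m and R = 2^r. Up to equivalence, a Niho bent function f is recorded by its
hyperoval with (0:1) as distinguished point. A collineation from D(t^R) to this hyperoval sends some
point P of D(t^R) to (0:1). In coordinates where P is (0:1), the other points form the graph of a
function h on F × F, homogeneous of degree 1, and f is tr ∘ h up to an additive bijection and an
additive summand (`isModelledBy_of_graph`). There are three kinds of P: (0:1:0), (1:0:0) and the
affine points, which the translations (t, t^R) permute transitively. They give h = X^e Y^(q-e) with
e = 2^r, 2^(m-r) and the inverse of 1 - 2^r modulo q - 1 (`exists_isGraph`), hence at most three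
classes.

All three occur: in the coordinates X = ⟨a,x⟩, Y = ⟨1,x⟩ (with i for a in the third case), each
listed function is tr(X^e Y^(q-e)) plus the trace of a linear map (`gTrans_eq`,
`isAssociated_of_monoMap`). Bentness reduces to counting roots of t^e + αt + β: one if α = 0,
otherwise none or two (`sum_traceChar_monoMap`, `rootCount_two_pow`, `rootCount_invExp`).

The classes differ by algebraic degree, which equivalence preserves as long as it is positive.
Binary weights of exponents give degree r + 1 for f_r and m - r + 1 for f_{m-r}; these are distinct,
and below m because 1 < r < m - 1. The third function has degree at least m. Lower bounds on degree
come from moments: a function of degree less than 2m sums to zero over F × F, whereas a suitable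
complementary monomial gives a nonzero sum. -/

namespace Niho

/-! ### Absolute traces and the additive character of F -/

section Trace

variable {F K : Type*} [Field F] [Fintype F] [Field K] [Fintype K] [Algebra F K]
  [Algebra (ZMod 2) F] [Algebra (ZMod 2) K]

theorem isScalarTower_zmod_two : IsScalarTower (ZMod 2) F K :=
  IsScalarTower.of_algebraMap_eq' (Subsingleton.elim _ _)

theorem charP_two : CharP F 2 :=
  charP_of_injective_algebraMap (algebraMap (ZMod 2) F).injective 2

theorem trace_ringEquiv (σ : F ≃+* F) (x : F) :
    Algebra.trace (ZMod 2) F (σ x) = Algebra.trace (ZMod 2) F x :=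
  Algebra.trace_eq_of_algEquiv
    (AlgEquiv.ofRingEquiv (f := σ) fun z =>
      congrArg (fun g : ZMod 2 →+* F => g z)
        (Subsingleton.elim ((σ : F →+* F).comp (algebraMap (ZMod 2) F)) (algebraMap (ZMod 2) F))) x

theorem trace_pow_two_pow (x : F) (j : ℕ) :
    Algebra.trace (ZMod 2) F (x ^ 2 ^ j) = Algebra.trace (ZMod 2) F x := by
  have : CharP F 2 := charP_two
  simpa [iterateFrobenius_def] using trace_ringEquiv (iterateFrobeniusEquiv F 2 j) x

theorem finrank_zmod_two {m : ℕ} (hF : Fintype.card F = 2 ^ m) :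
    Module.finrank (ZMod 2) F = m := by
  have h := Module.card_eq_pow_finrank (K := ZMod 2) (V := F)
  rw [hF, ZMod.card] at h
  exact (Nat.pow_right_injective le_rfl h).symm

theorem algebraMap_trace_zmod_two {m : ℕ} (hF : Fintype.card F = 2 ^ m) (x : F) :
    algebraMap (ZMod 2) F (Algebra.trace (ZMod 2) F x) = ∑ j ∈ Finset.range m, x ^ 2 ^ j := by
  rw [FiniteField.algebraMap_trace_eq_sum_pow, finrank_zmod_two hF]
  simp

/-- The additive character `x ↦ (-1) ^ tr x` of `F`. -/
noncomputable def traceChar (F : Type*) [Field F] [Algebra (ZMod 2) F] : AddChar F ℤ where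
  toFun x := (-1) ^ (Algebra.trace (ZMod 2) F x).val
  map_zero_eq_one' := by simp
  map_add_eq_mul' x y := by
    rw [map_add]
    generalize Algebra.trace (ZMod 2) F x = a
    generalize Algebra.trace (ZMod 2) F y = b
    revert a b
    decide

theorem sum_traceChar_mul [DecidableEq F] (b : F) :
    ∑ x : F, traceChar F (x * b) = if b = 0 then (Fintype.card F : ℤ) else 0 := by
  have h : traceChar F ≠ 1 := by
    intro h
    obtain ⟨x, hx⟩ := Algebra.trace_surjective (ZMod 2) F 1
    have := DFunLike.congr_fun h x
    simp [traceChar, hx, ZMod.val_one] at this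
  have := AddChar.sum_mulShift b (AddChar.IsPrimitive.of_ne_one h)
  rw [this]
  split_ifs <;> simp

end Trace

/-! ### Conjugation, the form, and polar coordinates on K -/

section Conj

variable {F K : Type*} [Field F] [Fintype F] [Field K] [Algebra F K]

/-- Conjugation as an `F`-algebra homomorphism. -/
noncomputable def conjHom (F K : Type*) [Field F] [Fintype F] [Field K] [Algebra F K] :
    K →ₐ[F] K :=
  FiniteField.frobeniusAlgHom F K

theorem conjHom_apply (x : K) : conjHom F K x = conj F x := rfl

theorem conj_smul (c : F) (x : K) : conj F (c • x) = c • conj F x :=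
  map_smul (conjHom F K) c x

variable [Fintype K]

theorem algebraMap_trace (hK : Module.finrank F K = 2) (x : K) :
    algebraMap F K (Algebra.trace F K x) = x + conj F x := by
  rw [FiniteField.algebraMap_trace_eq_sum_pow, hK, Finset.sum_range_succ, Finset.sum_range_one]
  simp [conj]

theorem conj_conj (hK : Module.finrank F K = 2) (x : K) : conj F (conj F x) = x := by
  have h := Module.card_eq_pow_finrank (K := F) (V := K)
  rw [conj, conj, ← pow_mul, ← sq, ← hK, ← h, FiniteField.pow_card]

theorem algebraMap_form (hK : Module.finrank F K = 2) (x y : K) :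
    algebraMap F K (form F x y) = x * conj F y + conj F x * y := by
  rw [form, algebraMap_trace hK]
  simp only [← conjHom_apply, map_mul]
  simp only [conjHom_apply, conj_conj hK]

/-- The form as a linear map in its second argument. -/
noncomputable def formLin (F : Type*) {K : Type*} [Field F] [Fintype F] [Field K] [Algebra F K]
    (b : K) : K →ₗ[F] F :=
  Algebra.trace F K ∘ₗ LinearMap.mulLeft F b ∘ₗ (conjHom F K).toLinearMap

theorem formLin_apply (b x : K) : formLin F b x = form F b x := rfl

theorem form_one (hK : Module.finrank F K = 2) (x : K) : form F 1 x = Algebra.trace F K x := by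
  apply (algebraMap F K).injective
  rw [algebraMap_form hK, algebraMap_trace hK, one_mul, ← conjHom_apply, ← conjHom_apply, map_one,
    one_mul, add_comm]

/-- The coordinates `x ↦ (⟨i, x⟩, ⟨1, x⟩)`, as a linear map. -/
noncomputable def coordLin (F : Type*) {K : Type*} [Field F] [Fintype F] [Field K] [Algebra F K]
    (i : K) : K →ₗ[F] F × F :=
  (formLin F i).prod (formLin F 1)

/-- The left side is x(i + conj i) + 2 i conj x. Thus 1, i is a basis of K over F whose coordinate
functions are the two forms. -/
theorem smul_one_add_smul (hK : Module.finrank F K = 2) [CharP K 2] {i : K} (hi : i + conj F i = 1)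
    (x : K) : form F i x • (1 : K) + form F 1 x • i = x := by
  have h1 : conj F (1 : K) = 1 := map_one (conjHom F K)
  rw [Algebra.smul_def, Algebra.smul_def, algebraMap_form hK, algebraMap_form hK, h1]
  have h2 := CharTwo.add_self_eq_zero (i * conj F x)
  linear_combination x * hi + h2

theorem coordLin_injective (hK : Module.finrank F K = 2) [CharP K 2] {i : K}
    (hi : i + conj F i = 1) : Function.Injective (coordLin F i) := by
  intro x y h
  rw [← smul_one_add_smul hK hi x, ← smul_one_add_smul hK hi y]
  have h1 : form F i x = form F i y := congrArg Prod.fst h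
  have h2 : form F 1 x = form F 1 y := congrArg Prod.snd h
  rw [h1, h2]

/-- The coordinates `x ↦ (⟨i, x⟩, ⟨1, x⟩)`, as a linear equivalence. -/
noncomputable def coords (hK : Module.finrank F K = 2) [CharP K 2] {i : K}
    (hi : i + conj F i = 1) : K ≃ₗ[F] F × F :=
  LinearMap.linearEquivOfInjective (coordLin F i) (coordLin_injective hK hi)
    (by simp [hK])

/-- Polar decomposition: the norm of x has a square root c in F, and x / c has norm 1. -/
theorem exists_smul_unitCircle [CharP F 2] (hK : Module.finrank F K = 2) {x : K} (hx : x ≠ 0) :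
    ∃ (c : F) (u : unitCircle F K), c ≠ 0 ∧ x = c • (u : K) := by
  have hn : algebraMap F K (Algebra.norm F x) = x * conj F x := by
    rw [FiniteField.algebraMap_norm_eq_prod_pow, hK, Finset.prod_range_succ, Finset.prod_range_one]
    simp [conj]
  obtain ⟨c, hc⟩ := (frobeniusEquiv F 2).surjective (Algebra.norm F x)
  have hc' : c ^ 2 = Algebra.norm F x := by simpa [frobenius_def] using hc
  have hc0 : c ≠ 0 := by
    rintro rfl
    apply hx
    have : Algebra.norm F x = 0 := by rw [← hc']; simp
    exact Algebra.norm_eq_zero_iff.1 this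
  refine ⟨c, ⟨c⁻¹ • x, ?_⟩, hc0, by simp [smul_smul, hc0]⟩
  show c⁻¹ • x * conj F (c⁻¹ • x) = 1
  rw [conj_smul, smul_mul_smul_comm, Algebra.smul_def, ← hn, ← hc', ← map_mul]
  rw [show c⁻¹ * c⁻¹ * c ^ 2 = 1 by field_simp, map_one]

end Conj

/-! ### Boolean functions on F × F as models -/

section Model

variable {F K : Type*} [Field F] [Fintype F] [Field K] [Fintype K] [Algebra F K]
  [Algebra (ZMod 2) F] [Algebra (ZMod 2) K]

/-- The map `(X, Y) ↦ X ^ e * Y ^ (q - e)`, homogeneous of degree `1` when `q = |F|`. -/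
def monoMap (q e : ℕ) (w : F × F) : F := w.1 ^ e * w.2 ^ (q - e)

theorem monoMap_smul {q e : ℕ} (hq : Fintype.card F = q) (he : e ≤ q) (c : F) (w : F × F) :
    monoMap q e (c • w) = c * monoMap q e w := by
  have h : c ^ e * c ^ (q - e) = c := by
    rw [← pow_add, Nat.add_sub_cancel' he, ← hq, FiniteField.pow_card]
  simp only [monoMap, Prod.smul_fst, Prod.smul_snd, smul_eq_mul, mul_pow]
  linear_combination (w.1 ^ e * w.2 ^ (q - e)) * h

theorem monoMap_zero {q e : ℕ} (he : e ≠ 0) : monoMap q e (0 : F × F) = 0 := by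
  simp [monoMap, he]

/-- `f` is the Boolean function `t` on `F × F`, up to an additive change of coordinates and an
additive function. -/
def IsModelledBy (f : K → ZMod 2) (t : F × F → ZMod 2) : Prop :=
  ∃ (L : F × F ≃+ K) (l : F × F →+ ZMod 2), ∀ w, f (L w) = t w + l w

theorem IsModelledBy.eaEquiv {f f' : K → ZMod 2} {t : F × F → ZMod 2} (h : IsModelledBy f t)
    (h' : IsModelledBy f' t) : EAEquiv f f' := by
  obtain ⟨L, l, hL⟩ := h
  obtain ⟨L', l', hL'⟩ := h'
  -- Pass through the common model by L ∘ L'⁻¹; an additive map of 𝔽₂-spaces is automatically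
  -- linear.
  refine ⟨LinearEquiv.toAffineEquiv
      { (L'.symm.trans L) with
        map_smul' := ((L'.symm.trans L).toAddMonoidHom.toZModLinearMap 2).map_smul },
    (((l + l').comp L'.symm.toAddMonoidHom).toZModLinearMap 2).toAffineMap, fun x => ?_⟩
  obtain ⟨w, rfl⟩ := L'.surjective x
  have h2 : f' (L' w) = f (L w) + (l w + l' w) := by
    rw [hL, hL']
    linear_combination (- CharTwo.add_self_eq_zero (l w))
  simpa using h2

end Model

/-! ### Point sets as cones of vectors -/

section Cone

/-- Turns an equality of point sets into a condition on representing vectors, which is easier to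
check in coordinates. -/
theorem projEquiv_iff {F V W : Type*} [Field F] [AddCommGroup V] [Module F V] [AddCommGroup W]
    [Module F W] {A : Set (ℙ F V)} {B : Set (ℙ F W)} :
    ProjEquiv A B ↔ ∃ (σ : F ≃+* F) (φ : V →ₛₗ[(σ : F →+* F)] W), Function.Bijective φ ∧
      ∀ v (hv : v ≠ 0) (hv' : φ v ≠ 0),
        Projectivization.mk F v hv ∈ A ↔ Projectivization.mk F (φ v) hv' ∈ B := by
  constructor
  · rintro ⟨σ, φ, hφ, rfl⟩
    refine ⟨σ, φ, hφ, fun v hv hv' => ?_⟩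
    rw [← Projectivization.map_mk φ hφ.1 v hv]
    refine ⟨fun h => Set.mem_image_of_mem _ h, ?_⟩
    rintro ⟨p, hp, h⟩
    induction p using Projectivization.ind with
    | h w hw =>
      rw [Projectivization.map_mk, Projectivization.map_mk, Projectivization.mk_eq_mk_iff'] at h
      obtain ⟨c, hc⟩ := h
      have hc' : σ.symm c • v = w := hφ.1 (by simpa using hc)
      convert hp using 1
      rw [eq_comm, Projectivization.mk_eq_mk_iff']
      exact ⟨_, hc'⟩
  · rintro ⟨σ, φ, hφ, h⟩
    refine ⟨σ, φ, hφ, Set.Subset.antisymm ?_ ?_⟩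
    · rintro _ ⟨p, hp, rfl⟩
      induction p using Projectivization.ind with
      | h v hv =>
        rw [Projectivization.map_mk]
        exact (h v hv _).1 hp
    · intro p hp
      induction p using Projectivization.ind with
      | h w hw =>
        obtain ⟨v, rfl⟩ := hφ.2 w
        have hv : v ≠ 0 := by rintro rfl; simp at hw
        exact ⟨_, (h v hv hw).2 hp, Projectivization.map_mk φ hφ.1 v hv⟩

variable {F K : Type*} [Field F] [Fintype F] [Field K] [Algebra F K]

theorem mk_mem_hyperovalOfG {g : unitCircle F K → F} {v : K × F} (hv : v ≠ 0) :
    Projectivization.mk F v hv ∈ hyperovalOfG F g ↔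
      v.1 = 0 ∨ ∃ (c : F) (u : unitCircle F K), v.1 = c • (u : K) ∧ v.2 = c * g u := by
  constructor
  · rintro (⟨u, hu⟩ | h)
    · right
      rw [eq_comm, Projectivization.mk_eq_mk_iff'] at hu
      obtain ⟨c, rfl⟩ := hu
      exact ⟨c, u, rfl, rfl⟩
    · left
      rw [Set.mem_singleton_iff, Projectivization.mk_eq_mk_iff'] at h
      obtain ⟨c, rfl⟩ := h
      simp
  · rintro (h | ⟨c, u, h1, h2⟩)
    · right
      rw [Set.mem_singleton_iff, Projectivization.mk_eq_mk_iff']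
      exact ⟨v.2, by ext <;> simp [h]⟩
    · left
      refine ⟨u, ?_⟩
      rw [eq_comm, Projectivization.mk_eq_mk_iff']
      exact ⟨c, by ext <;> simp [h1, h2]⟩

theorem mk_mem_hyperovalD {R : ℕ} (hR : R ≠ 0) {v : Fin 3 → F} (hv : v ≠ 0) :
    Projectivization.mk F v hv ∈ hyperovalD (fun t : F => t ^ R) ↔
      (v 2 = 0 ∧ (v 0 = 0 ∨ v 1 = 0)) ∨ (v 2 ≠ 0 ∧ v 0 ^ R = v 1 * v 2 ^ (R - 1)) := by
  have hR1 : R - 1 + 1 = R := by omega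
  constructor
  · rintro (⟨t, ht⟩ | h | h)
    · rw [eq_comm, Projectivization.mk_eq_mk_iff'] at ht
      obtain ⟨c, rfl⟩ := ht
      by_cases hc : c = 0
      · exact absurd (by simp [hc]) hv
      · right
        have : c ^ R = c * c ^ (R - 1) := by rw [← pow_succ', hR1]
        simp [mul_pow, this, hc]
        ring
    all_goals
      obtain ⟨c, rfl⟩ := (Projectivization.mk_eq_mk_iff' F _ _ _ _).1 h
      simp
  · rintro (⟨h, h1⟩ | ⟨h, h1⟩)
    · right
      simp only [Set.mem_insert_iff, Set.mem_singleton_iff]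
      rw [Projectivization.mk_eq_mk_iff', Projectivization.mk_eq_mk_iff']
      exact h1.imp (fun h0 => ⟨v 1, by ext j; fin_cases j <;> simp [h0, h]⟩)
        (fun h0 => ⟨v 0, by ext j; fin_cases j <;> simp [h0, h]⟩)
    · left
      refine ⟨v 0 / v 2, ?_⟩
      rw [eq_comm, Projectivization.mk_eq_mk_iff']
      refine ⟨v 2, ?_⟩
      have h3 : v 2 ^ R = v 2 ^ (R - 1) * v 2 := by rw [← pow_succ, hR1]
      have : v 2 * (v 0 / v 2) ^ R = v 1 := by
        rw [div_pow, h1, h3]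
        field_simp
      ext j; fin_cases j
      · simp; field_simp
      · simpa using this
      · simp

end Cone

/-! ### The exponent e, inverse to 1 - 2^r modulo q - 1 -/

section Exponent

/-- A subtraction-free form of e(1 - 2^r) ≡ 1, so that x^(e(2^r - 1)) = x⁻¹ on F*. -/
theorem dvd_invExp (m r : ℕ) (hrm : Nat.gcd r m = 1) (hm : 0 < m) :
    2 ^ m - 1 ∣ invExp m r * (2 ^ r - 1) + 1 := by
  have h1 : 1 < 2 ^ m := Nat.one_lt_two_pow hm.ne'
  have : NeZero (2 ^ m - 1) := ⟨by omega⟩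
  rw [← ZMod.natCast_eq_zero_iff, Nat.cast_add, Nat.cast_mul, invExp, ZMod.natCast_zmod_val,
    Nat.cast_sub Nat.one_le_two_pow]
  have := invExp_spec m r hrm
  push_cast
  linear_combination (-1) * this

theorem invExp_lt (m r : ℕ) (hm : 0 < m) : invExp m r < 2 ^ m - 1 := by
  have h1 : 1 < 2 ^ m := Nat.one_lt_two_pow hm.ne'
  have : NeZero (2 ^ m - 1) := ⟨by omega⟩
  exact ZMod.val_lt _

theorem invExp_ne_zero (m r : ℕ) (hrm : Nat.gcd r m = 1) (hm : 1 < m) : invExp m r ≠ 0 := by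
  intro h
  have h1 : 2 ^ 2 ≤ 2 ^ m := Nat.pow_le_pow_right (by norm_num) hm
  have := dvd_invExp m r hrm (by omega)
  rw [h, zero_mul, zero_add, Nat.dvd_one] at this
  omega

variable {F : Type*} [Field F] [Fintype F]

theorem pow_eq_one_of_dvd {q n : ℕ} (hq : Fintype.card F = q) {x : F} (hx : x ≠ 0)
    (h : q - 1 ∣ n) : x ^ n = 1 := by
  obtain ⟨c, rfl⟩ := h
  rw [pow_mul, ← hq, FiniteField.pow_card_sub_one_eq_one x hx, one_pow]

end Exponent

/-! ### The translation hyperoval as a graph, seen from each of its points -/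

section Graph

variable {F V : Type*} [Field F] [Fintype F] [AddCommGroup V] [Module F V]

/-- In the coordinates `κ`, the point set `A` is the graph of `h` together with `(0 : 1)`. -/
def IsGraph (A : Set (ℙ F V)) (κ : V ≃ₗ[F] (F × F) × F) (h : F × F → F) : Prop :=
  ∀ v (hv : v ≠ 0), Projectivization.mk F v hv ∈ A ↔ (κ v).1 = 0 ∨ (κ v).2 = h (κ v).1

/-- The coordinates `((x, z), y)`. -/
def coordsXZ (F : Type*) [Field F] : (Fin 3 → F) ≃ₗ[F] (F × F) × F where
  toFun v := ((v 0, v 2), v 1)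
  invFun p := ![p.1.1, p.2, p.1.2]
  map_add' _ _ := rfl
  map_smul' _ _ := rfl
  left_inv v := by ext j; fin_cases j <;> rfl
  right_inv _ := rfl

theorem coordsXZ_apply (v : Fin 3 → F) : coordsXZ F v = ((v 0, v 2), v 1) := rfl

/-- The coordinates `((y, z), x)`. -/
def coordsYZ (F : Type*) [Field F] : (Fin 3 → F) ≃ₗ[F] (F × F) × F where
  toFun v := ((v 1, v 2), v 0)
  invFun p := ![p.2, p.1.1, p.1.2]
  map_add' _ _ := rfl
  map_smul' _ _ := rfl
  left_inv v := by ext j; fin_cases j <;> rfl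
  right_inv _ := rfl

theorem coordsYZ_apply (v : Fin 3 → F) : coordsYZ F v = ((v 1, v 2), v 0) := rfl

/-- The coordinates `((y - b z, x - a z), z)`. -/
def coordsShift {F : Type*} [Field F] (a b : F) : (Fin 3 → F) ≃ₗ[F] (F × F) × F where
  toFun v := ((v 1 - b * v 2, v 0 - a * v 2), v 2)
  invFun p := ![p.1.2 + a * p.2, p.1.1 + b * p.2, p.2]
  map_add' v w := by ext <;> simp <;> ring
  map_smul' c v := by ext <;> simp <;> ring
  left_inv v := by ext j; fin_cases j <;> simp
  right_inv _ := by simp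

theorem coordsShift_apply (a b : F) (v : Fin 3 → F) :
    coordsShift a b v = ((v 1 - b * v 2, v 0 - a * v 2), v 2) := rfl

theorem isGraph_coordsXZ {m r : ℕ} (hF : Fintype.card F = 2 ^ m) (hrm : r < m) :
    IsGraph (hyperovalD (fun t : F => t ^ 2 ^ r)) (coordsXZ F) (monoMap (2 ^ m) (2 ^ r)) := by
  intro v hv
  rw [mk_mem_hyperovalD (by positivity)]
  have hlt : 2 ^ r < 2 ^ m := Nat.pow_lt_pow_right (by norm_num) hrm
  have hpos : 0 < 2 ^ r := by positivity
  simp only [coordsXZ_apply, monoMap,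
    Prod.mk_eq_zero]
  by_cases h : v 2 = 0
  · have : 2 ^ m - 2 ^ r ≠ 0 := by omega
    simp [h, this]
  · have h1 : v 2 ^ (2 ^ m - 2 ^ r) * v 2 ^ (2 ^ r - 1) = 1 := by
      rw [← pow_add]
      exact pow_eq_one_of_dvd hF h (by rw [show 2 ^ m - 2 ^ r + (2 ^ r - 1) = 2 ^ m - 1 by omega])
    simp only [h, false_and, false_or, ne_eq, not_false_eq_true, true_and, and_false]
    constructor
    · intro h2; rw [h2]; linear_combination (- v 1) * h1
    · intro h2; rw [h2]; linear_combination (- v 0 ^ 2 ^ r) * h1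

theorem isGraph_coordsYZ {m r : ℕ} (hF : Fintype.card F = 2 ^ m) [CharP F 2] (hr : r ≠ 0)
    (hrm : r < m) :
    IsGraph (hyperovalD (fun t : F => t ^ 2 ^ r)) (coordsYZ F)
      (monoMap (2 ^ m) (2 ^ (m - r))) := by
  intro v hv
  rw [mk_mem_hyperovalD (by positivity)]
  have hlt : 2 ^ (m - r) < 2 ^ m := Nat.pow_lt_pow_right (by norm_num) (by omega)
  have hpos : 0 < 2 ^ r := by positivity
  have hmul : 2 ^ (m - r) * 2 ^ r = 2 ^ m := by rw [← pow_add]; congr 1; omega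
  simp only [coordsYZ_apply, monoMap,
    Prod.mk_eq_zero]
  by_cases h : v 2 = 0
  · have : 2 ^ m - 2 ^ (m - r) ≠ 0 := by omega
    simp [h, this, or_comm]
  -- Since 2^(m-r) · 2^r = q, raising y^(2^(m-r)) z^(q - 2^(m-r)) to the power 2^r gives back the
  -- right side of x^(2^r) = y z^(2^r - 1).
  · have h1 : (v 1 ^ 2 ^ (m - r) * v 2 ^ (2 ^ m - 2 ^ (m - r))) ^ 2 ^ r
        = v 1 * v 2 ^ (2 ^ r - 1) := by
      apply mul_right_cancel₀ (pow_ne_zero (2 ^ m) h)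
      rw [mul_pow, ← pow_mul, hmul, ← pow_mul, Nat.sub_mul, hmul, mul_assoc, ← pow_add,
        Nat.sub_add_cancel (Nat.le_mul_of_pos_right _ hpos), ← hF, pow_mul,
        FiniteField.pow_card, FiniteField.pow_card, mul_assoc, ← pow_succ,
        Nat.sub_add_cancel hpos]
    simp only [h, false_and, false_or, ne_eq, not_false_eq_true, true_and, and_false]
    rw [← h1]
    have : Function.Injective fun x : F => x ^ 2 ^ r := by
      intro x y hxy
      exact iterateFrobenius_inj F 2 r (by simpa [iterateFrobenius_def] using hxy)
    exact this.eq_iff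

/-- Off the coordinate lines, x^R = y z^(R-1) says (z/x)^(R-1) = (y/x)⁻¹, where R = 2^r. As e(R - 1)
≡ -1, this is z/x = (y/x)^e, that is, z = y^e x^(q-e). -/
theorem isGraph_coordsShift_zero {m r : ℕ} (hF : Fintype.card F = 2 ^ m) (hm : 1 < m)
    (hrm : Nat.gcd r m = 1) :
    IsGraph (hyperovalD (fun t : F => t ^ 2 ^ r)) (coordsShift 0 0)
      (monoMap (2 ^ m) (invExp m r)) := by
  intro v hv
  rw [mk_mem_hyperovalD (by positivity)]
  have hpos : 0 < 2 ^ r := by positivity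
  have he := dvd_invExp m r hrm (by omega)
  have he1 := invExp_lt m r (by omega)
  have he0 := invExp_ne_zero m r hrm hm
  simp only [coordsShift_apply, monoMap,
    Prod.mk_eq_zero, zero_mul, sub_zero]
  generalize invExp m r = e at *
  generalize v 0 = a, v 1 = b, v 2 = c
  have hqe : 2 ^ m - e ≠ 0 := by omega
  have hR : 2 ^ r - 1 + 1 = 2 ^ r := by omega
  by_cases ha : a = 0
  · subst ha
    by_cases hc : c = 0 <;> simp [hc, hqe]
  by_cases hc : c = 0
  · subst hc
    simp [ha, he0, hqe]
  by_cases hb : b = 0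
  · subst hb
    simp [ha, hc, he0]
  have h1 {x : F} (hx : x ≠ 0) : x ^ (e * (2 ^ r - 1)) * x = 1 := by
    rw [← pow_succ]; exact pow_eq_one_of_dvd hF hx he
  have h2 : a ^ (2 ^ m - e) * a ^ e = a := by
    rw [← pow_add, Nat.sub_add_cancel (by omega), ← hF, FiniteField.pow_card]
  have h3 : c = b ^ e * a ^ (2 ^ m - e) ↔ c * a ^ e = b ^ e * a := by
    rw [← mul_left_inj' (pow_ne_zero e ha), mul_assoc (b ^ e), h2]
  simp only [ha, hc, hb, false_or, ne_eq, not_false_eq_true, true_and, and_false, h3]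
  -- One direction raises the equation to the power e, the other to the power 2^r - 1; `h1` then
  -- turns x^(e(2^r - 1)) into x⁻¹.
  constructor
  · intro h
    have h4 : a ^ (2 ^ r * e) = b ^ e * c ^ (e * (2 ^ r - 1)) := by
      rw [pow_mul, h, mul_pow, ← pow_mul, mul_comm e]
    have h5 : a ^ (2 ^ r * e) = a ^ (e * (2 ^ r - 1)) * a ^ e := by
      rw [← pow_add, ← Nat.mul_succ, Nat.succ_eq_add_one, hR, mul_comm]
    linear_combination (-c * a ^ e) * h1 ha + a * c * (h4 - h5) + (a * b ^ e) * h1 hc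
  · intro h
    have h4 := congrArg (· ^ (2 ^ r - 1)) h
    simp only [mul_pow, ← pow_mul] at h4
    have h5 : a ^ 2 ^ r = a ^ (2 ^ r - 1) * a := by rw [← pow_succ, hR]
    linear_combination h5 - a ^ (2 ^ r - 1) * a * h1 hb - a * b * h4 + b * c ^ (2 ^ r - 1) * h1 ha

/-- Additivity of t ↦ t^(2^r) makes (x, y, z) ↦ (x - tz, y - t^(2^r) z, z) preserve the hyperoval,
which reduces everything to t = 0. -/
theorem isGraph_coordsShift {m r : ℕ} (hF : Fintype.card F = 2 ^ m) [CharP F 2] (hm : 1 < m)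
    (hrm : Nat.gcd r m = 1) (t : F) :
    IsGraph (hyperovalD (fun t : F => t ^ 2 ^ r)) (coordsShift t (t ^ 2 ^ r))
      (monoMap (2 ^ m) (invExp m r)) := by
  intro v hv
  have hR : 2 ^ r - 1 + 1 = 2 ^ r := Nat.sub_add_cancel Nat.one_le_two_pow
  have hw : ![v 0 - t * v 2, v 1 - t ^ 2 ^ r * v 2, v 2] ≠ 0 := by
    intro h
    have h0 := congrFun h 0
    have h1 := congrFun h 1
    have h2 : v 2 = 0 := congrFun h 2
    simp [h2] at h0 h1
    exact hv (by ext j; fin_cases j <;> simp [h0, h1, h2])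
  have key := isGraph_coordsShift_zero hF hm hrm _ hw
  simp only [coordsShift_apply, zero_mul,
    sub_zero] at key ⊢
  refine Iff.trans ?_ key
  rw [mk_mem_hyperovalD (by positivity), mk_mem_hyperovalD (by positivity)]
  simp only [Matrix.cons_val]
  by_cases h : v 2 = 0
  · simp [h]
  · have h2 : v 2 ^ 2 ^ r = v 2 ^ (2 ^ r - 1) * v 2 := by rw [← pow_succ, hR]
    simp only [h, false_and, false_or, ne_eq, not_false_eq_true, true_and]
    rw [sub_pow_char_pow, mul_pow, h2, sub_mul, mul_assoc, mul_comm (v 2), sub_left_inj]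

/-- The coordinates adapted to a point of the translation hyperoval. -/
theorem exists_isGraph {m r : ℕ} (hF : Fintype.card F = 2 ^ m) [CharP F 2] (hm : 1 < m)
    (hr : r ≠ 0) (hr' : r < m) (hrm : Nat.gcd r m = 1) {v : Fin 3 → F} (hv : v ≠ 0)
    (hv' : Projectivization.mk F v hv ∈ hyperovalD (fun t : F => t ^ 2 ^ r)) :
    ∃ e ∈ ({2 ^ r, 2 ^ (m - r), invExp m r} : Set ℕ), ∃ κ : (Fin 3 → F) ≃ₗ[F] (F × F) × F,
      (κ v).1 = 0 ∧ IsGraph (hyperovalD (fun t : F => t ^ 2 ^ r)) κ (monoMap (2 ^ m) e) := by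
  rw [mk_mem_hyperovalD (by positivity)] at hv'
  rcases hv' with ⟨h2, h | h⟩ | ⟨h2, h⟩
  · exact ⟨_, by simp, coordsXZ F, by simp [coordsXZ_apply, h2, h], isGraph_coordsXZ hF hr'⟩
  · exact ⟨_, by simp, coordsYZ F, by simp [coordsYZ_apply, h2, h], isGraph_coordsYZ hF hr hr'⟩
  · refine ⟨_, by simp, coordsShift (v 0 / v 2) ((v 0 / v 2) ^ 2 ^ r), ?_,
      isGraph_coordsShift hF hm hrm _⟩
    have hR : v 2 ^ 2 ^ r = v 2 ^ (2 ^ r - 1) * v 2 := by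
      rw [← pow_succ, Nat.sub_add_cancel Nat.one_le_two_pow]
    simp only [coordsShift_apply, Prod.mk_eq_zero]
    rw [div_pow, h, hR]
    constructor <;> field_simp <;> simp

end Graph

/-! ### From associated hyperovals to models, and back -/

section Associated

variable {F K V : Type*} [Field F] [Fintype F] [Field K] [Fintype K] [Algebra F K]
  [Algebra (ZMod 2) F] [Algebra (ZMod 2) K] [AddCommGroup V] [Module F V]

/-- The shear (w, z) ↦ (E⁻¹w, z + B(E⁻¹w)) maps the graph of h to that of h ∘ E + B, the homogeneous
extension of g to K; it fixes (0:1). -/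
theorem projEquiv_of_isGraph [CharP F 2] (hK : Module.finrank F K = 2) {A : Set (ℙ F V)}
    {κ : V ≃ₗ[F] (F × F) × F} {h : F × F → F} (hκ : IsGraph A κ h)
    (hh : ∀ (c : F) w, h (c • w) = c * h w) (E : K ≃ₗ[F] F × F) (B : K →ₗ[F] F)
    {g : unitCircle F K → F} (hg : ∀ u : unitCircle F K, g u = h (E u) + B u) :
    ProjEquiv A (hyperovalOfG F g) := by
  rw [projEquiv_iff]
  let φ : V →ₛₗ[((RingEquiv.refl F : F ≃+* F) : F →+* F)] K × F :=
    { toFun := fun v => (E.symm (κ v).1, (κ v).2 + B (E.symm (κ v).1))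
      map_add' := fun v w => by
        ext
        · simp
        · simp only [map_add, Prod.snd_add, Prod.fst_add]; ring
      map_smul' := fun c v => by
        ext
        · simp
        · simp [mul_add] }
  have hφ (v : V) : φ v = (E.symm (κ v).1, (κ v).2 + B (E.symm (κ v).1)) := rfl
  refine ⟨RingEquiv.refl F, φ, ⟨?_, ?_⟩, fun v hv hv' => ?_⟩
  · rw [injective_iff_map_eq_zero]
    intro v hv
    rw [hφ, Prod.mk_eq_zero, LinearEquiv.map_eq_zero_iff] at hv
    have h2 := hv.2
    rw [hv.1, map_zero, map_zero, add_zero] at h2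
    exact κ.map_eq_zero_iff.1 (Prod.ext hv.1 h2)
  · rintro ⟨x, z⟩
    refine ⟨κ.symm (E x, z - B x), ?_⟩
    rw [hφ]
    simp
  · rw [hκ v hv, mk_mem_hyperovalOfG, hφ]
    generalize (κ v).1 = w, (κ v).2 = z
    simp only [LinearEquiv.map_eq_zero_iff]
    by_cases hw : w = 0
    · simp [hw]
    simp only [hw, false_or]
    constructor
    · rintro rfl
      obtain ⟨c, u, -, hu⟩ := exists_smul_unitCircle hK (x := E.symm w) (by simpa using hw)
      refine ⟨c, u, hu, ?_⟩
      have : w = c • E u := by rw [← map_smul, ← hu, LinearEquiv.apply_symm_apply]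
      rw [hg, hu, this, hh, map_smul, smul_eq_mul]
      ring
    · rintro ⟨c, u, hu, hz⟩
      have : w = c • E u := by rw [← map_smul, ← hu, LinearEquiv.apply_symm_apply]
      rw [hg, hu, map_smul, smul_eq_mul] at hz
      rw [this, hh]
      linear_combination hz

/-- The vector ψ(w, h w) is ρ(u, g(u)) for some ρ and u, so f(c⁻¹ρu) = tr(c⁻¹ρ g(u)) reads off its
second coordinate. That coordinate is additive in w, apart from the term c σ(h w), which contributes
tr(σ(h w)) = tr(h w). So the semilinear twist σ leaves no trace in the model. -/
theorem isModelledBy_of_graph {f : K → ZMod 2} {g : unitCircle F K → F} (hfg : Corresponds F f g)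
    {h : F × F → F} (h0 : h 0 = 0) {σ : F ≃+* F}
    {ψ : (F × F) × F →ₛₗ[(σ : F →+* F)] K × F} (hψ : Function.Bijective ψ) {c : F}
    (hc : ψ (0, 1) = (0, c))
    (hgraph : ∀ w (hw : ψ (w, h w) ≠ 0), Projectivization.mk F (ψ (w, h w)) hw ∈ hyperovalOfG F g) :
    IsModelledBy f (fun w => Algebra.trace (ZMod 2) F (h w)) := by
  have hdec (w : F × F) (z : F) : ψ (w, z) = ψ (w, 0) + (0, σ z * c) := by
    have : (w, z) = (w, 0) + z • ((0, 1) : (F × F) × F) := by ext <;> simp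
    rw [this, map_add, LinearMap.map_smulₛₗ, hc]
    ext <;> simp
  have hc0 : c ≠ 0 := by
    rintro rfl
    have h1 : ((0, 1) : (F × F) × F) = 0 := hψ.1 (by rw [hc, map_zero]; rfl)
    simp at h1
  have hfst (w : F × F) (z : F) : (ψ (w, z)).1 = (ψ (w, 0)).1 := by rw [hdec]; simp
  have hinj (w : F × F) (hw : (ψ (w, 0)).1 = 0) : w = 0 := by
    have h1 : ψ (w, - σ.symm ((ψ (w, 0)).2 / c)) = 0 := by
      rw [hdec]
      ext
      · simp [hw]
      · simp [hc0]
    rw [hψ.1.eq_iff' (map_zero ψ)] at h1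
    exact congrArg Prod.fst h1
  have hadd (w w' : F × F) : (w + w', (0 : F)) = (w, 0) + (w', 0) := by simp
  -- The factor c⁻¹ cancels the scalar with which ψ moves (0, 1).
  let A : F × F →+ K :=
    { toFun := fun w => c⁻¹ • (ψ (w, 0)).1
      map_zero' := by
        have : ψ (0, 0) = 0 := map_zero ψ
        simp [this]
      map_add' := fun w w' => by
        rw [← smul_add, ← Prod.fst_add, ← map_add, ← hadd] }
  have hA (w : F × F) : A w = c⁻¹ • (ψ (w, 0)).1 := rfl
  let l : F × F →+ ZMod 2 :=
    { toFun := fun w => Algebra.trace (ZMod 2) F (c⁻¹ * (ψ (w, 0)).2)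
      map_zero' := by
        have : ψ (0, 0) = 0 := map_zero ψ
        simp [this]
      map_add' := fun w w' => by
        rw [← map_add, ← mul_add, ← Prod.snd_add, ← map_add, ← hadd] }
  have hbij : Function.Bijective A := by
    refine ⟨(injective_iff_map_eq_zero A).2 fun w hw => hinj w ?_, fun x => ?_⟩
    · rw [hA, smul_eq_zero] at hw
      exact hw.resolve_left (inv_ne_zero hc0)
    · obtain ⟨⟨w, z⟩, hw⟩ := hψ.2 (c • x, 0)
      refine ⟨w, ?_⟩
      rw [hA, ← hfst w z, hw, inv_smul_smul₀ hc0]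
  refine ⟨AddEquiv.ofBijective A hbij, l, fun w => ?_⟩
  show f (A w) = Algebra.trace (ZMod 2) F (h w) + Algebra.trace (ZMod 2) F (c⁻¹ * (ψ (w, 0)).2)
  by_cases hw : w = 0
  · subst hw
    have h1 : ψ (0, 0) = 0 := map_zero ψ
    have h2 := hfg ⟨1, by simp [unitCircle, conj]⟩ 0
    rw [map_zero, show ψ (0, 0) = 0 from h1, h0]
    simpa using h2
  · have hne : (ψ (w, h w)).1 ≠ 0 := fun h1 => hw (hinj w (by rwa [hfst] at h1))
    obtain ⟨ρ, u, h1, h2⟩ := ((mk_mem_hyperovalOfG _).1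
      (hgraph w fun h3 => hne (by rw [h3]; rfl))).resolve_left hne
    rw [hA, ← hfst w (h w), h1, smul_smul, hfg, mul_assoc, ← h2, hdec,
      ← trace_ringEquiv σ (h w), ← map_add]
    congr 1
    simp only [Prod.snd_add]
    field_simp
    ring

theorem exists_isModelledBy {m r : ℕ} (hF : Fintype.card F = 2 ^ m) (hm : 1 < m)
    (hr : r ≠ 0) (hr' : r < m) (hrm : Nat.gcd r m = 1) {f : K → ZMod 2}
    (hf : IsAssociated (hyperovalD (fun t : F => t ^ 2 ^ r)) f) :
    ∃ e ∈ ({2 ^ r, 2 ^ (m - r), invExp m r} : Set ℕ),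
      IsModelledBy f (fun w : F × F => Algebra.trace (ZMod 2) F (monoMap (2 ^ m) e w)) := by
  have : CharP F 2 := charP_two
  obtain ⟨-, g, hfg, hH⟩ := hf
  obtain ⟨σ, φ, hφ, hH⟩ := projEquiv_iff.1 hH
  obtain ⟨v, hv⟩ := hφ.2 (0, 1)
  have hv0 : v ≠ 0 := by
    rintro rfl
    rw [map_zero] at hv
    simpa using congrArg Prod.snd hv
  have hvH := (hH v hv0 (by rw [hv]; simp)).2
    ((mk_mem_hyperovalOfG _).2 (Or.inl (by rw [hv])))
  obtain ⟨e, he, κ, hκv, hκ⟩ := exists_isGraph hF hm hr hr' hrm hv0 hvH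
  refine ⟨e, he, ?_⟩
  have he0 : e ≠ 0 := by
    rcases he with rfl | rfl | rfl
    · positivity
    · positivity
    · exact invExp_ne_zero m r hrm hm
  have hz : (κ v).2 ≠ 0 := fun h => hv0 (κ.map_eq_zero_iff.1 (Prod.ext hκv h))
  let ψ : (F × F) × F →ₛₗ[(σ : F →+* F)] K × F := φ.comp κ.symm.toLinearMap
  have hψ (p : (F × F) × F) : ψ p = φ (κ.symm p) := rfl
  have hψb : Function.Bijective ψ := hφ.comp κ.symm.bijective
  -- Here κ v = (0, z₀) and φ v = (0, 1), so ψ(0, 1) = (0, σ(z₀⁻¹)).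
  refine isModelledBy_of_graph hfg (monoMap_zero he0) hψb (c := σ (κ v).2⁻¹) ?_ ?_
  · have h1 : ((0, 1) : (F × F) × F) = (κ v).2⁻¹ • κ v := by
      ext <;> simp [hκv, hz]
    rw [hψ, h1, map_smul, LinearEquiv.symm_apply_apply, LinearMap.map_smulₛₗ, hv]
    ext <;> simp
  · intro w hw
    have h1 : κ.symm (w, monoMap (2 ^ m) e w) ≠ 0 := by
      intro h2
      rw [hψ, h2, map_zero] at hw
      exact hw rfl
    exact (hH _ h1 hw).1 ((hκ _ h1).2 (by simp))

end Associated

/-! ### Bentness by counting roots of t^e + αt + β -/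

section Bent

variable {F K : Type*} [Field F] [Fintype F] [Field K] [Fintype K] [Algebra F K]
  [Algebra (ZMod 2) F] [Algebra (ZMod 2) K]

theorem pow_injective_of_coprime {q n : ℕ} (hq : Fintype.card F = q) (hn0 : n ≠ 0)
    (hn : Nat.Coprime n (q - 1)) : Function.Injective fun x : F => x ^ n := by
  intro x y hxy
  simp only at hxy
  by_cases hx : x = 0
  · subst hx
    rw [zero_pow hn0, eq_comm, pow_eq_zero_iff hn0] at hxy
    exact hxy.symm
  have hy : y ≠ 0 := by
    rintro rfl
    rw [zero_pow hn0, pow_eq_zero_iff hn0] at hxy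
    exact hx hxy
  have hcard : (Nat.card Fˣ).Coprime n := by
    rw [Nat.card_units, Nat.card_eq_fintype_card, hq]
    exact hn.symm
  have h : Units.mk0 x hx = Units.mk0 y hy :=
    (powCoprime hcard).injective (Units.ext (by simpa using hxy))
  simpa using congrArg Units.val h

open Classical in
/-- The number of roots of `t ^ e + α * t + β` in `F`. -/
noncomputable def rootCount (e : ℕ) (α β : F) : ℕ :=
  (Finset.univ.filter fun t : F => t ^ e + α * t + β = 0).card

theorem rootCount_zero [CharP F 2] {e : ℕ} (he : Function.Injective fun x : F => x ^ e) (β : F) :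
    rootCount e 0 β = 1 := by
  classical
  obtain ⟨t, ht⟩ := (Finite.injective_iff_surjective.1 he) β
  simp only at ht
  rw [rootCount, Finset.card_eq_one]
  refine ⟨t, Finset.ext fun x => ?_⟩
  simp only [zero_mul, add_zero, Finset.mem_filter, Finset.mem_univ, true_and,
    Finset.mem_singleton, CharTwo.add_eq_zero, ← ht]
  exact he.eq_iff

/-- The map t ↦ t^(2^s) + αt is additive with kernel {0, z}, where z^(2^s - 1) = α. Such a z exists
and is unique because 2^s - 1 is coprime to 2^m - 1. -/
theorem rootCount_two_pow [CharP F 2] {m s : ℕ} (hF : Fintype.card F = 2 ^ m) (hs : s ≠ 0)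
    (hsm : Nat.gcd s m = 1) {α : F} (hα : α ≠ 0) (β : F) :
    rootCount (2 ^ s) α β = 0 ∨ rootCount (2 ^ s) α β = 2 := by
  classical
  rw [or_iff_not_imp_left, rootCount, ← ne_eq, Finset.card_ne_zero]
  rintro ⟨t, ht⟩
  have h2 : 2 ≤ 2 ^ s := Nat.pow_le_pow_right (n := 2) (by norm_num) (Nat.one_le_iff_ne_zero.2 hs)
  have hinj : Function.Injective fun x : F => x ^ (2 ^ s - 1) := by
    refine pow_injective_of_coprime hF (by omega) ?_
    simp [Nat.Coprime, Nat.pow_sub_one_gcd_pow_sub_one, hsm]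
  obtain ⟨z, hz⟩ := (Finite.injective_iff_surjective.1 hinj) α
  simp only at hz
  have hz0 : z ≠ 0 := by
    rintro rfl
    rw [zero_pow (by omega)] at hz
    exact hα hz.symm
  rw [Finset.card_eq_two]
  refine ⟨t, t + z, by simpa using hz0, Finset.ext fun x => ?_⟩
  simp only [Finset.mem_filter, Finset.mem_univ, true_and, Finset.mem_insert,
    Finset.mem_singleton] at ht ⊢
  have hxt : x ^ 2 ^ s = (x - t) ^ 2 ^ s + t ^ 2 ^ s := by rw [sub_pow_char_pow]; ring
  have hpow (y : F) : y ^ 2 ^ s = y ^ (2 ^ s - 1) * y := by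
    rw [← pow_succ]; congr 1; omega
  have key : x ^ 2 ^ s + α * x + β = ((x - t) ^ (2 ^ s - 1) + α) * (x - t) := by
    rw [hxt]
    linear_combination ht + hpow (x - t)
  rw [key, mul_eq_zero, CharTwo.add_eq_zero, or_comm, sub_eq_zero, ← hz, hinj.eq_iff,
    sub_eq_iff_eq_add, add_comm z]

theorem coprime_invExp {m r : ℕ} (hm : 1 < m) (hrm : Nat.gcd r m = 1) :
    Nat.Coprime (invExp m r) (2 ^ m - 1) := by
  rw [Nat.coprime_iff_isRelPrime]
  intro d hd hd'
  have h1 := hd'.trans (dvd_invExp m r hrm (by omega))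
  rw [Nat.dvd_add_right (hd.mul_right _)] at h1
  exact isUnit_of_dvd_one h1

/-- For nonzero t substitute t = v^(2^r - 1), so that t^e = v⁻¹; multiplying by v/α gives v^(2^r) +
(β/α)v + 1/α = 0, an equation of the preceding type. The root t = 0 occurs exactly when β = 0, and
then the new equation has one root. -/
theorem rootCount_invExp [CharP F 2] {m r : ℕ} (hF : Fintype.card F = 2 ^ m) (hm : 1 < m)
    (hr : r ≠ 0) (hrm : Nat.gcd r m = 1) {α : F} (hα : α ≠ 0) (β : F) :
    rootCount (invExp m r) α β = 0 ∨ rootCount (invExp m r) α β = 2 := by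
  classical
  have h2 : 2 ≤ 2 ^ r := Nat.pow_le_pow_right (n := 2) (by norm_num) (Nat.one_le_iff_ne_zero.2 hr)
  have hinj : Function.Injective fun x : F => x ^ (2 ^ r - 1) := by
    refine pow_injective_of_coprime hF (by omega) ?_
    simp [Nat.Coprime, Nat.pow_sub_one_gcd_pow_sub_one, hrm]
  have he0 := invExp_ne_zero m r hrm hm
  have hpow (y : F) : y ^ 2 ^ r = y ^ (2 ^ r - 1) * y := by
    rw [← pow_succ]; congr 1; omega
  have hinv {v : F} (hv : v ≠ 0) : (v ^ (2 ^ r - 1)) ^ invExp m r * v = 1 := by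
    rw [← pow_mul, mul_comm (2 ^ r - 1), ← pow_succ]
    exact pow_eq_one_of_dvd hF hv (dvd_invExp m r hrm (by omega))
  have hv0 {v : F} (h : v ^ 2 ^ r + β / α * v + 1 / α = 0) : v ≠ 0 := by
    rintro rfl
    simp [hα] at h
  have key : rootCount (invExp m r) α β =
      (if β = 0 then 1 else 0) + rootCount (2 ^ r) (β / α) (1 / α) := by
    have hset : (Finset.univ.filter fun t : F => t ^ invExp m r + α * t + β = 0) =
        (if β = 0 then {0} else ∅) ∪ (Finset.univ.filter fun v : F =>
          v ^ 2 ^ r + β / α * v + 1 / α = 0).image fun x => x ^ (2 ^ r - 1) := by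
      ext t
      simp only [Finset.mem_filter, Finset.mem_univ, true_and, Finset.mem_union, Finset.mem_image]
      have h0 : t ∈ (if β = 0 then {0} else ∅ : Finset F) ↔ β = 0 ∧ t = 0 := by
        split_ifs with h <;> simp [h]
      rw [h0]
      have hv {v : F} (hv : v ≠ 0) :
          (v ^ (2 ^ r - 1)) ^ invExp m r + α * v ^ (2 ^ r - 1) + β = 0 ↔
            v ^ 2 ^ r + β / α * v + 1 / α = 0 := by
        rw [← mul_left_inj' hv, ← mul_right_inj' (inv_ne_zero hα), zero_mul, mul_zero]
        have : α⁻¹ * (((v ^ (2 ^ r - 1)) ^ invExp m r + α * v ^ (2 ^ r - 1) + β) * v) =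
            v ^ 2 ^ r + β / α * v + 1 / α := by
          rw [hpow]
          field_simp
          linear_combination hinv hv
        rw [this]
      constructor
      · intro h
        by_cases ht : t = 0
        · subst ht
          left
          simpa [he0] using h
        · right
          obtain ⟨v, rfl⟩ := (Finite.injective_iff_surjective.1 hinj) t
          have hv1 : v ≠ 0 := by
            rintro rfl
            exact ht (zero_pow (by omega))
          exact ⟨v, (hv hv1).1 h, rfl⟩
      · rintro (⟨rfl, rfl⟩ | ⟨v, h, rfl⟩)
        · simp [he0]
        · exact (hv (hv0 h)).2 h
    rw [rootCount, rootCount, hset, Finset.card_union_of_disjoint,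
      Finset.card_image_of_injective _ hinj]
    · congr 1
      split_ifs <;> simp
    · rw [Finset.disjoint_left]
      intro t ht ht'
      obtain ⟨v, hv, rfl⟩ := Finset.mem_image.1 ht'
      rw [Finset.mem_filter] at hv
      split_ifs at ht
      · exact pow_ne_zero _ (hv0 hv.2) (Finset.mem_singleton.1 ht)
      · simp at ht
  rw [key]
  by_cases hβ : β = 0
  · right
    rw [if_pos hβ, hβ, zero_div, rootCount_zero]
    exact fun x y hxy =>
      iterateFrobenius_inj F 2 r (by simpa [iterateFrobenius_def] using hxy)
  · rw [if_neg hβ, zero_add]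
    exact rootCount_two_pow hF hr hrm (div_ne_zero hβ hα) _

open Classical in
-- For y ≠ 0 put x = ty: homogeneity makes the argument y(t^e + αt + β). Summing over all y counts
-- the roots t, q times each; the line y = 0 must be corrected, from q to the true value q or 0.
theorem sum_traceChar_monoMap {q e : ℕ} (hq : Fintype.card F = q) (he : e < q)
    (α β : F) :
    ∑ w : F × F, traceChar F (monoMap q e w + (α * w.1 + β * w.2)) =
      q * ((if α = 0 then 1 else 0) + rootCount e α β - 1) := by
  have hqe : q - e ≠ 0 := by omega
  let S (y : F) := ∑ x : F, traceChar F (monoMap q e (x, y) + (α * x + β * y))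
  let T (y : F) := ∑ t : F, traceChar F (y * (t ^ e + α * t + β))
  have hS : S 0 = if α = 0 then (q : ℤ) else 0 := by
    rw [← hq, ← sum_traceChar_mul α]
    refine Finset.sum_congr rfl fun x _ => ?_
    simp [monoMap, hqe, mul_comm]
  have hT0 : T 0 = q := by simp [T, hq]
  have hST (y : F) (hy : y ≠ 0) : S y = T y := by
    refine (Fintype.sum_equiv (Equiv.mulRight₀ y hy) _ _ fun t => ?_).symm
    change traceChar F (y * (t ^ e + α * t + β)) =
      traceChar F (monoMap q e (t * y, y) + (α * (t * y) + β * y))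
    have h1 : y ^ e * y ^ (q - e) = y := by
      rw [← pow_add, Nat.add_sub_cancel' he.le, ← hq, FiniteField.pow_card]
    congr 1
    simp only [monoMap, mul_pow]
    linear_combination (- t ^ e) * h1
  have hT : ∑ y, T y = q * rootCount e α β := by
    simp only [T]
    rw [Finset.sum_comm]
    simp only [sum_traceChar_mul]
    rw [← Finset.sum_filter, Finset.sum_const, hq, rootCount, nsmul_eq_mul, mul_comm]
  rw [Fintype.sum_prod_type_right]
  have h1 : ∑ y, S y = S 0 + (∑ y, T y - T 0) := by
    rw [← Finset.add_sum_erase _ S (Finset.mem_univ 0),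
      ← Finset.add_sum_erase _ T (Finset.mem_univ 0), add_sub_cancel_left]
    congr 1
    exact Finset.sum_congr rfl fun y hy => hST y (Finset.ne_of_mem_erase hy)
  refine h1.trans ?_
  rw [hS, hT0, hT]
  split_ifs <;> ring

theorem isBent_of_monoMap {q e : ℕ} (hq : Fintype.card F = q) (he : e < q)
    (h0 : ∀ β : F, rootCount e 0 β = 1)
    (h1 : ∀ α β : F, α ≠ 0 → rootCount e α β = 0 ∨ rootCount e α β = 2)
    (E : K ≃ₗ[F] F × F) (B : K →ₗ[F] F) {f : K → ZMod 2}
    (hf : ∀ x, f x = Algebra.trace (ZMod 2) F (monoMap q e (E x) + B x)) : IsBent F f := by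
  classical
  intro b
  let φ : K →ₗ[F] F := B + formLin F b
  have hφ (w : F × F) : φ (E.symm w) = φ (E.symm (1, 0)) * w.1 + φ (E.symm (0, 1)) * w.2 := by
    have hw : w = w.1 • ((1, 0) : F × F) + w.2 • ((0, 1) : F × F) := by ext <;> simp
    conv_lhs => rw [hw]
    simp only [map_add, map_smul, smul_eq_mul]
    ring
  have hsum : walsh F f b = ∑ w : F × F, traceChar F (monoMap q e w +
      (φ (E.symm (1, 0)) * w.1 + φ (E.symm (0, 1)) * w.2)) := by
    refine Fintype.sum_equiv E.toEquiv _ _ fun x => ?_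
    rw [← hφ]
    have : φ (E.symm (E.toEquiv x)) = B x + form F b x := by
      simp [φ, formLin_apply]
    rw [this, hf, ← map_add]
    simp [traceChar, add_assoc]
  rw [hsum, sum_traceChar_monoMap hq he, hq]
  generalize φ (E.symm (1, 0)) = α, φ (E.symm (0, 1)) = β
  by_cases hα : α = 0
  · left
    rw [hα, h0]
    simp
  · rw [if_neg hα]
    rcases h1 α β hα with h | h <;> rw [h] <;> simp

end Bent

/-! ### The g-functions of the trace representatives -/

section GFunction

variable {F K : Type*} [Field F] [Fintype F] [Field K] [Fintype K] [Algebra F K]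
  [Algebra (ZMod 2) F] [Algebra (ZMod 2) K]

/-- The product telescopes, since uv = 1 and equal terms cancel in characteristic 2. -/
theorem mul_one_add_sum_pow {R : Type*} [CommRing R] [CharP R 2] {u v : R} (h : u * v = 1)
    (n : ℕ) : (u + v) * (1 + ∑ i ∈ Finset.range n, (u ^ (2 * (i + 1)) + v ^ (2 * (i + 1)))) =
      u ^ (2 * n + 1) + v ^ (2 * n + 1) := by
  induction n with
  | zero => simp
  | succ n ih =>
    rw [Finset.sum_range_succ, ← add_assoc, mul_add, ih]
    have h1 := CharTwo.add_self_eq_zero (u ^ (2 * n + 1))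
    have h2 := CharTwo.add_self_eq_zero (v ^ (2 * n + 1))
    linear_combination (v ^ (2 * n + 1) + u ^ (2 * n + 1)) * h + h1 + h2

theorem add_conj_ne_zero [CharP K 2] {u : unitCircle F K} (hu : (u : K) ≠ 1) :
    (u : K) + conj F (u : K) ≠ 0 := by
  intro h
  have h1 : (u : K) * conj F (u : K) = 1 := u.2
  rw [CharTwo.add_eq_zero] at h
  rw [← h] at h1
  rw [← sq, ← one_pow (M := K) 2] at h1
  exact hu (CharTwo.sq_injective h1)

theorem nihoExp_ne_zero {m r : ℕ} (hm : 1 < m) (hr : r ≤ 2 * m) (j : ℕ) : nihoExp m r j ≠ 0 := by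
  intro h
  have h1 := nihoExp_spec m r j hr
  rw [h, mul_zero] at h1
  have h2 : 2 ^ m - 1 ∣ 2 ^ (2 * m) - 1 := Nat.pow_sub_one_dvd_pow_sub_one _ (by simp)
  have h3 := h2.trans ((Nat.modEq_zero_iff_dvd).1 h1.symm)
  rw [Nat.dvd_add_right (Dvd.intro _ rfl)] at h3
  have h4 : 2 ^ 2 ≤ 2 ^ m := Nat.pow_le_pow_right (by norm_num) hm
  have h5 : Nat.Coprime (2 ^ m - 1) (2 ^ r) := by
    apply Nat.Coprime.pow_right
    rw [Nat.coprime_two_right]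
    exact Nat.Even.sub_odd Nat.one_le_two_pow (Nat.even_pow.2 ⟨even_two, by omega⟩) odd_one
  have := h5.eq_one_of_dvd h3
  omega

theorem conj_pow (x : K) (n : ℕ) : conj F (x ^ n) = conj F x ^ n := map_pow (conjHom F K) x n

/-- By the defining congruence the exponent on the left becomes (q - 1)j + 2^r. On F* the first term
disappears; on the unit circle u^(q-1) = u⁻². -/
theorem pow_nihoExp_pow {m r j : ℕ} (hF : Fintype.card F = 2 ^ m)
    (hK : Module.finrank F K = 2) (hm : 1 < m) (hr : r ≠ 0) (hrm : r ≤ 2 * m)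
    (hj : j ≤ 2 ^ (r - 1)) (c : F) (u : unitCircle F K) :
    ((c • (u : K)) ^ nihoExp m r j) ^ 2 ^ r =
      c ^ 2 ^ r • (u : K) ^ (2 * (2 ^ (r - 1) - j)) := by
  -- At c = 0 exponents cannot be reduced modulo q² - 1; both sides vanish because the Niho exponent
  -- is nonzero.
  by_cases hc : c = 0
  · subst hc
    simp [nihoExp_ne_zero hm hrm j]
  have hu0 := unitCircle_ne_zero F u
  have hx0 : c • (u : K) ≠ 0 := by simp [hc, hu0]
  have hcard : Fintype.card K = 2 ^ (2 * m) := by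
    rw [Module.card_eq_pow_finrank (K := F) (V := K), hK, hF, ← pow_mul, mul_comm]
  have hone : (c • (u : K)) ^ (2 ^ (2 * m) - 1) = 1 := by
    rw [← hcard, FiniteField.pow_card_sub_one_eq_one _ hx0]
  have hspec : (c • (u : K)) ^ (2 ^ r * nihoExp m r j) =
      (c • (u : K)) ^ ((2 ^ m - 1) * j + 2 ^ r) := by
    rw [pow_eq_pow_mod _ hone, nihoExp_spec m r j hrm, ← pow_eq_pow_mod _ hone]
  rw [← pow_mul, mul_comm, hspec, smul_pow]
  congr 1
  · rw [pow_add, pow_mul, ← hF, FiniteField.pow_card_sub_one_eq_one c hc, one_pow, one_mul]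
  · have h1 : (u : K) * conj F (u : K) = 1 := u.2
    have h2 : (u : K) ^ (2 ^ m - 1) * (u : K) ^ 2 = 1 := by
      have : 2 ^ m - 1 + 2 = 2 ^ m + 1 := by have := Nat.one_le_two_pow (n := m); omega
      rw [← pow_add, this, pow_succ, ← hF, mul_comm]
      exact h1
    have h3 : 2 ^ r = 2 * 2 ^ (r - 1) := by rw [← pow_succ']; congr 1; omega
    have h4 : 2 ^ r = 2 * j + 2 * (2 ^ (r - 1) - j) := by omega
    rw [h4, pow_add, pow_mul, pow_add, pow_mul (u : K) 2 j, ← mul_assoc, ← mul_pow, h2, one_pow,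
      one_mul]

theorem trace_pow_two_pow_right [CharP K 2] (hK : Module.finrank F K = 2) (x : K) (n : ℕ) :
    Algebra.trace F K x ^ 2 ^ n = Algebra.trace F K (x ^ 2 ^ n) := by
  apply (algebraMap F K).injective
  rw [map_pow, algebraMap_trace hK, algebraMap_trace hK, add_pow_char_pow, conj_pow]

/-- Since u^(2^(m-r) · 2^r) = conj u, the quotient becomes T(u^(2^r - 1)) / T(u) with T the trace to
F, which the telescoping identity expands. -/
theorem gTrans_pow {m r : ℕ} (hF : Fintype.card F = 2 ^ m) [CharP K 2]
    (hK : Module.finrank F K = 2) (hr : r ≠ 0) (hrm : r ≤ m) (u : unitCircle F K) :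
    gTrans F m r u ^ 2 ^ r = 1 + ∑ j ∈ Finset.Icc 1 (2 ^ (r - 1) - 1),
      Algebra.trace F K ((u : K) ^ (2 * (2 ^ (r - 1) - j))) := by
  apply (algebraMap F K).injective
  have huv : (u : K) * conj F (u : K) = 1 := u.2
  have hM : 2 ^ (r - 1) - 1 + 1 = 2 ^ (r - 1) := Nat.sub_add_cancel Nat.one_le_two_pow
  have h3 : 2 ^ r = 2 * 2 ^ (r - 1) := by rw [← pow_succ']; congr 1; omega
  have hsum : ∑ j ∈ Finset.Icc 1 (2 ^ (r - 1) - 1),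
      algebraMap F K (Algebra.trace F K ((u : K) ^ (2 * (2 ^ (r - 1) - j)))) =
      ∑ i ∈ Finset.range (2 ^ (r - 1) - 1),
        ((u : K) ^ (2 * (i + 1)) + conj F (u : K) ^ (2 * (i + 1))) := by
    -- Reverse the order of summation: i + 1 = 2^(r-1) - j.
    refine Finset.sum_bij' (fun j _ => 2 ^ (r - 1) - 1 - j) (fun i _ => 2 ^ (r - 1) - 1 - i)
      ?_ ?_ ?_ ?_ ?_
    · intro j hj; rw [Finset.mem_Icc] at hj; rw [Finset.mem_range]; omega
    · intro i hi; rw [Finset.mem_range] at hi; rw [Finset.mem_Icc]; omega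
    · intro j hj; rw [Finset.mem_Icc] at hj; omega
    · intro i hi; rw [Finset.mem_range] at hi; omega
    · intro j hj
      rw [Finset.mem_Icc] at hj
      rw [algebraMap_trace hK, conj_pow,
        show 2 ^ (r - 1) - 1 - j + 1 = 2 ^ (r - 1) - j by omega]
  rw [map_add, map_one, map_sum, hsum]
  by_cases hu : (u : K) = 1
  · have : conj F (u : K) = 1 := by rw [hu]; exact map_one (conjHom F K)
    rw [gTrans, if_pos hu, this, hu]
    simp [CharTwo.add_self_eq_zero]
  · have hne := add_conj_ne_zero hu
    have key := mul_one_add_sum_pow huv (2 ^ (r - 1) - 1)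
    rw [← mul_right_inj' hne, key, gTrans, if_neg hu, div_pow, trace_pow_two_pow_right hK,
      trace_pow_two_pow_right hK, mul_pow, ← pow_mul _ (2 ^ (m - r)),
      ← pow_add 2, Nat.sub_add_cancel hrm, ← hF]
    change _ * algebraMap F K (Algebra.trace F K ((u : K) ^ 2 ^ r * conj F (u : K)) /
      Algebra.trace F K (conj F (u : K))) = _
    have hR : (u : K) ^ 2 ^ r * conj F (u : K) = (u : K) ^ (2 ^ r - 1) := by
      have : 2 ^ r = 2 ^ r - 1 + 1 := (Nat.sub_add_cancel Nat.one_le_two_pow).symm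
      rw [this, pow_succ, mul_assoc, huv, mul_one, ← this]
    rw [hR, map_div₀, algebraMap_trace hK, algebraMap_trace hK, conj_conj hK, conj_pow,
      add_comm (conj F (u : K)), mul_div_cancel₀ _ hne,
      show 2 * (2 ^ (r - 1) - 1) + 1 = 2 ^ r - 1 by omega]

theorem corresponds_fTrans {m r : ℕ} (hF : Fintype.card F = 2 ^ m)
    (hK : Module.finrank F K = 2) (hm : 1 < m) (hr : r ≠ 0) (hrm : r ≤ m) {a : K}
    (ha : a + conj F a = 1) : Corresponds F (fTrans m r a) (gTrans F m r) := by
  intro u c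
  have : CharP F 2 := charP_two
  have : CharP K 2 := charP_two
  have : IsScalarTower (ZMod 2) F K := isScalarTower_zmod_two
  have huv : (u : K) * conj F (u : K) = 1 := u.2
  have hTa : Algebra.trace F K a = 1 := by
    apply (algebraMap F K).injective
    rw [algebraMap_trace hK, ha, map_one]
  have h1 : Algebra.trace (ZMod 2) K (a * (c • (u : K)) ^ (2 ^ m + 1)) =
      Algebra.trace (ZMod 2) F c := by
    have : a * (c • (u : K)) ^ (2 ^ m + 1) = c ^ 2 ^ 1 • a := by
      have h2 : (c • (u : K)) ^ (2 ^ m) = c • conj F (u : K) := by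
        rw [← conj_smul, conj, hF]
      rw [pow_succ, h2, smul_mul_smul_comm, mul_comm (conj F (u : K)), huv, mul_smul_comm, mul_one,
        pow_one, sq]
    rw [this, ← Algebra.trace_trace (S := F), map_smul, hTa, smul_eq_mul, mul_one,
      trace_pow_two_pow]
  have h2 (j : ℕ) (hj : j ∈ Finset.Icc 1 (2 ^ (r - 1) - 1)) :
      Algebra.trace (ZMod 2) K ((c • (u : K)) ^ nihoExp m r j) =
        Algebra.trace (ZMod 2) F (c ^ 2 ^ r *
          Algebra.trace F K ((u : K) ^ (2 * (2 ^ (r - 1) - j)))) := by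
    rw [Finset.mem_Icc] at hj
    rw [← trace_pow_two_pow _ r, pow_nihoExp_pow hF hK hm hr (by omega) (by omega),
      ← Algebra.trace_trace (S := F), map_smul, smul_eq_mul]
  rw [fTrans, map_add, map_sum, Finset.sum_congr rfl h2, h1, ← map_sum, ← Finset.mul_sum,
    ← trace_pow_two_pow c r, ← map_add, ← mul_one_add, ← gTrans_pow hF hK hr hrm, ← mul_pow,
    trace_pow_two_pow]

/-- Put k = 2^(m-r) and u = X + Ya. With T(1) = 0 and T(a) = 1, T(u^k) = Y^k and T(u · u^k) = XY^k +
X^kY + Y^(k+1) T(a^(k+1)). Dividing leaves X^k Y^(q-k) plus a linear form; u = 1 is the case Y = 0.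
-/
theorem gTrans_eq {m r : ℕ} (hF : Fintype.card F = 2 ^ m) [CharP F 2] [CharP K 2]
    (hK : Module.finrank F K = 2) (hr : r ≠ 0) (hrm : r ≤ m) {a : K}
    (ha : a + conj F a = 1) (u : unitCircle F K) :
    gTrans F m r u = monoMap (2 ^ m) (2 ^ (m - r)) (form F a (u : K), form F 1 (u : K)) +
      (form F a (u : K) + Algebra.trace F K (a ^ 2 ^ (m - r) * a) * form F 1 (u : K)) := by
  have hu := smul_one_add_smul hK ha (u : K)
  have hTa : Algebra.trace F K a = 1 := by
    apply (algebraMap F K).injective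
    rw [algebraMap_trace hK, ha, map_one]
  have hT1 : Algebra.trace F K (1 : K) = 0 := by
    apply (algebraMap F K).injective
    rw [algebraMap_trace hK, map_zero, ← conjHom_apply, map_one, CharTwo.add_self_eq_zero]
  have hlt : 2 ^ (m - r) < 2 ^ m := Nat.pow_lt_pow_right (by norm_num) (by omega)
  by_cases h1 : (u : K) = 1
  · have hb : form F 1 (u : K) = 0 := by rw [form_one hK, h1, hT1]
    have ha1 : form F a (u : K) = 1 := by
      apply (algebraMap F K).injective
      rw [algebraMap_form hK, h1, ← conjHom_apply (F := F) (1 : K), map_one, mul_one, mul_one, ha,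
        map_one]
    have : 2 ^ m - 2 ^ (m - r) ≠ 0 := by omega
    rw [gTrans, if_pos h1, hb, ha1]
    simp [monoMap, this]
  · have hb : form F 1 (u : K) ≠ 0 := by
      intro h
      rw [form_one hK] at h
      have h2 := congrArg (algebraMap F K) h
      rw [algebraMap_trace hK, map_zero] at h2
      exact add_conj_ne_zero h1 h2
    rw [gTrans, if_neg h1]
    generalize form F a (u : K) = x at *
    generalize form F 1 (u : K) = y at *
    have hk : (u : K) ^ 2 ^ (m - r) =
        x ^ 2 ^ (m - r) • (1 : K) + y ^ 2 ^ (m - r) • a ^ 2 ^ (m - r) := by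
      rw [← hu, add_pow_char_pow, smul_pow, smul_pow, one_pow]
    have hTk : Algebra.trace F K ((u : K) ^ 2 ^ (m - r)) = y ^ 2 ^ (m - r) := by
      rw [hk, map_add, map_smul, map_smul, hT1, ← trace_pow_two_pow_right hK, hTa]
      simp
    have hTn : Algebra.trace F K ((u : K) * (u : K) ^ 2 ^ (m - r)) =
        x * y ^ 2 ^ (m - r) + x ^ 2 ^ (m - r) * y +
          y ^ 2 ^ (m - r) * y * Algebra.trace F K (a ^ 2 ^ (m - r) * a) := by
      have : (u : K) * (u : K) ^ 2 ^ (m - r) = (x * x ^ 2 ^ (m - r)) • (1 : K) +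
          (x * y ^ 2 ^ (m - r)) • a ^ 2 ^ (m - r) + (x ^ 2 ^ (m - r) * y) • a +
          (y ^ 2 ^ (m - r) * y) • (a ^ 2 ^ (m - r) * a) := by
        rw [hk]
        nth_rewrite 1 [← hu]
        simp only [Algebra.smul_def, map_mul]
        ring
      rw [this, map_add, map_add, map_add, map_smul, map_smul, map_smul, map_smul, hT1,
        ← trace_pow_two_pow_right hK, hTa]
      simp
    have hy : y ^ (2 ^ m - 2 ^ (m - r)) * y ^ 2 ^ (m - r) = y := by
      rw [← pow_add, Nat.sub_add_cancel hlt.le, ← hF, FiniteField.pow_card]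
    rw [hTk, hTn, div_eq_iff (pow_ne_zero _ hb), monoMap]
    linear_combination (- x ^ 2 ^ (m - r)) * hy

end GFunction

/-! ### Algebraic degree -/

section Degree

variable (F V : Type*) {V' : Type*} [Field F] [Algebra (ZMod 2) F]
  [AddCommGroup V] [Module (ZMod 2) V] [AddCommGroup V'] [Module (ZMod 2) V']

/-- The span over `F` of the affine Boolean functions on `V`; its `d`-th power consists of the
`F`-valued functions of algebraic degree at most `d`. -/
def affineSpan : Submodule F (V → F) :=
  Submodule.span F (Set.range fun (l : V →ᵃ[ZMod 2] ZMod 2) x => algebraMap (ZMod 2) F (l x))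

/-- The Boolean function `f` has algebraic degree at most `d`. -/
def HasDegLE {V : Type*} [AddCommGroup V] [Module (ZMod 2) V] (f : V → ZMod 2) (d : ℕ) : Prop :=
  (fun x => algebraMap (ZMod 2) F (f x)) ∈ affineSpan F V ^ d

variable {F V}

theorem affine_mem_affineSpan (l : V →ᵃ[ZMod 2] ZMod 2) :
    (fun x => algebraMap (ZMod 2) F (l x)) ∈ affineSpan F V :=
  Submodule.subset_span ⟨l, rfl⟩

theorem one_le_affineSpan : 1 ≤ affineSpan F V := by
  rw [Submodule.one_le]
  convert affine_mem_affineSpan (AffineMap.const (ZMod 2) V (1 : ZMod 2))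
  simp

theorem linear_mem_affineSpan [Fintype F] (φ : V →ₗ[ZMod 2] F) : ⇑φ ∈ affineSpan F V := by
  let b := Module.finBasis (ZMod 2) F
  have h : ⇑φ = ∑ j, b j • fun x => algebraMap (ZMod 2) F ((b.coord j ∘ₗ φ).toAffineMap x) := by
    ext x
    conv_lhs => rw [← b.sum_repr (φ x)]
    simp [Algebra.smul_def, mul_comm]
  rw [h]
  exact Submodule.sum_mem _ fun j _ => Submodule.smul_mem _ _ (affine_mem_affineSpan _)

theorem comp_mem_affineSpan_pow (L : V →ᵃ[ZMod 2] V') {p : V' → F} {d : ℕ}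
    (hp : p ∈ affineSpan F V' ^ d) : p ∘ L ∈ affineSpan F V ^ d := by
  let Φ : (V' → F) →ₐ[F] (V → F) := AlgHom.pi fun x => Pi.evalAlgHom F (fun _ => F) (L x)
  have h : (affineSpan F V').map Φ.toLinearMap ≤ affineSpan F V := by
    rw [affineSpan, Submodule.map_span_le]
    rintro _ ⟨l, rfl⟩
    exact affine_mem_affineSpan (l.comp L)
  have h2 : Φ p ∈ (affineSpan F V' ^ d).map Φ.toLinearMap := Submodule.mem_map_of_mem hp
  rw [Submodule.map_pow] at h2
  exact pow_le_pow_left' h d h2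

theorem HasDegLE.comp {f : V' → ZMod 2} {d : ℕ} (hf : HasDegLE F f d) (L : V →ᵃ[ZMod 2] V') :
    HasDegLE F (fun x => f (L x)) d :=
  comp_mem_affineSpan_pow L hf

theorem HasDegLE.add_affine {f : V → ZMod 2} {d : ℕ} (hf : HasDegLE F f d) (hd : d ≠ 0)
    (l : V →ᵃ[ZMod 2] ZMod 2) : HasDegLE F (fun x => f x + l x) d := by
  have h : affineSpan F V ≤ affineSpan F V ^ d := by
    simpa using pow_le_pow_right' (one_le_affineSpan (F := F) (V := V))
      (Nat.one_le_iff_ne_zero.2 hd)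
  simp only [HasDegLE, map_add]
  exact Submodule.add_mem _ hf (h (affine_mem_affineSpan l))

/-- The linear parts of d affine functions, d less than the dimension, share a nonzero kernel vector
v. Their product is invariant under x ↦ v + x, so its values cancel in pairs. -/
theorem sum_eq_zero_of_mem_affineSpan_pow [Fintype V] {d : ℕ}
    (hd : d < Module.finrank (ZMod 2) V) {p : V → F} (hp : p ∈ affineSpan F V ^ d) :
    ∑ x, p x = 0 := by
  have : CharP F 2 := charP_of_injective_algebraMap (algebraMap (ZMod 2) F).injective 2
  rw [affineSpan, Submodule.span_pow] at hp
  induction hp using Submodule.span_induction with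
  | zero => simp
  | add p q _ _ hp hq => simp [Finset.sum_add_distrib, hp, hq]
  | smul c p _ hp => simp [← Finset.mul_sum, hp]
  | mem p hp =>
    obtain ⟨s, rfl⟩ := Set.mem_pow.1 hp
    choose l hl using fun i => (s i).2
    have hker : LinearMap.ker (LinearMap.pi fun i => (l i).linear) ≠ ⊥ :=
      LinearMap.ker_ne_bot_of_finrank_lt (by simpa using hd)
    obtain ⟨v, hv, hv0⟩ := Submodule.exists_mem_ne_zero_of_ne_bot hker
    have hlv (i : Fin d) : (l i).linear v = 0 := congrFun (LinearMap.mem_ker.1 hv) i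
    have hinv (i : Fin d) (x : V) : (s i : V → F) (v + x) = (s i : V → F) x := by
      rw [← hl i]
      have : l i (v + x) = l i x := by
        have h := (l i).map_vadd x v
        simpa [hlv i] using h
      simp [this]
    have hprod (x : V) : (List.ofFn fun i => (s i : V → F)).prod (v + x) =
        (List.ofFn fun i => (s i : V → F)).prod x := by
      simp [List.prod_ofFn, Finset.prod_apply, hinv]
    have hvv : v + v = 0 := by
      rw [← two_smul (ZMod 2) v, show (2 : ZMod 2) = 0 from rfl, zero_smul]
    refine Finset.sum_involution (fun x _ => v + x) (fun x _ => ?_) (fun x _ _ => ?_)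
      (fun x _ => Finset.mem_univ _) (fun x _ => ?_)
    · rw [hprod, CharTwo.add_self_eq_zero]
    · simpa using hv0
    · rw [← add_assoc, hvv, zero_add]

/-- Each φ^(2^n) is again 𝔽₂-linear, so the degree is at most the number of powers of 2 in the
exponent. -/
theorem pow_sum_mem_affineSpan_pow [Fintype F] {ι : Type*} (φ : V →ₗ[ZMod 2] F) (n : ι → ℕ)
    (T : Finset ι) : (fun x => φ x ^ ∑ i ∈ T, 2 ^ n i) ∈ affineSpan F V ^ T.card := by
  classical
  have : CharP F 2 := charP_of_injective_algebraMap (algebraMap (ZMod 2) F).injective 2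
  induction T using Finset.induction_on with
  | empty => simp [← Pi.one_def]
  | insert j T hj ih =>
    rw [Finset.card_insert_of_notMem hj, pow_succ]
    have h : (fun x => φ x ^ ∑ i ∈ insert j T, 2 ^ n i) =
        (fun x => φ x ^ ∑ i ∈ T, 2 ^ n i) *
          ⇑(((iterateFrobenius F 2 (n j)).toAddMonoidHom.toZModLinearMap 2) ∘ₗ φ) := by
      ext x
      rw [Finset.sum_insert hj, pow_add, mul_comm]
      simp [iterateFrobenius_def]
    rw [h]
    exact Submodule.mul_mem_mul ih (linear_mem_affineSpan _)

end Degree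

/-! ### Degree bounds and test monomials -/

section Test

variable {F K : Type*} [Field F] [Fintype F] [Field K]
  [Algebra (ZMod 2) F] [Algebra (ZMod 2) K]

theorem finrank_prod_zmod_two {m : ℕ} (hF : Fintype.card F = 2 ^ m) :
    Module.finrank (ZMod 2) (F × F) = 2 * m := by
  rw [Module.finrank_prod, finrank_zmod_two hF, two_mul]

/-- A moment of sufficiently small degree shows that `f'` has larger degree than `f`. -/
theorem IsModelledBy.not_eaEquiv {m d d' : ℕ} (hF : Fintype.card F = 2 ^ m)
    {f f' : K → ZMod 2} {t t' : F × F → ZMod 2} (h : IsModelledBy f t) (h' : IsModelledBy f' t')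
    (ht : HasDegLE F t d) (hd : d ≠ 0) {p : F × F → F} (hp : p ∈ affineSpan F (F × F) ^ d')
    (hdd : d + d' < 2 * m) (hsum : ∑ w, algebraMap (ZMod 2) F (t' w) * p w ≠ 0) :
    ¬ EAEquiv f f' := by
  rintro ⟨L, l, hL⟩
  obtain ⟨A, b, hA⟩ := h
  obtain ⟨A', b', hA'⟩ := h'
  have h1 : HasDegLE F (fun x => f x) d := by
    have h2 := (ht.comp (A.symm.toAddMonoidHom.toZModLinearMap 2).toAffineMap).add_affine hd
      ((b.comp A.symm.toAddMonoidHom).toZModLinearMap 2).toAffineMap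
    convert h2 using 2 with x
    obtain ⟨w, rfl⟩ := A.surjective x
    simp [hA]
  -- An equivalence would transport the bound d to t', and the product of t' with p would have
  -- degree below 2m, hence zero sum.
  have h3 : HasDegLE F t' d := by
    have h4 := (((h1.comp L.toAffineMap).add_affine hd l).comp
      (A'.toAddMonoidHom.toZModLinearMap 2).toAffineMap).add_affine hd
        (b'.toZModLinearMap 2).toAffineMap
    convert h4 using 2 with w
    have h5 := hA' w
    rw [hL] at h5
    have h6 := CharTwo.add_self_eq_zero (b' w)
    simp only [LinearMap.coe_toAffineMap, AddMonoidHom.coe_toZModLinearMap]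
    change t' w = f (L (A' w)) + l (A' w) + b' w
    linear_combination (-1) * h5 - h6
  apply hsum
  refine sum_eq_zero_of_mem_affineSpan_pow (d := d + d') (by rwa [finrank_prod_zmod_two hF]) ?_
  rw [pow_add]
  exact Submodule.mul_mem_mul h3 hp

/-- The exponent of X is a power of 2 and that of Y is a sum of s powers of 2; the conjugates in the
trace only shift these. -/
theorem hasDegLE_monoMap {m s : ℕ} (hF : Fintype.card F = 2 ^ m) (hsm : s ≤ m) :
    HasDegLE F (fun w : F × F => Algebra.trace (ZMod 2) F (monoMap (2 ^ m) (2 ^ (m - s)) w))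
      (s + 1) := by
  have hexp : 2 ^ m - 2 ^ (m - s) = ∑ i ∈ Finset.range s, 2 ^ (m - s + i) := by
    simp only [pow_add]
    rw [← Finset.mul_sum, Nat.geomSum_eq le_rfl, Nat.div_one, Nat.mul_sub, ← pow_add,
      Nat.sub_add_cancel hsm, mul_one]
  have h (j : ℕ) : (fun w : F × F => monoMap (2 ^ m) (2 ^ (m - s)) w ^ 2 ^ j) ∈
      affineSpan F (F × F) ^ (s + 1) := by
    have h1 := pow_sum_mem_affineSpan_pow (LinearMap.fst (ZMod 2) F F) (fun _ : Unit => m - s + j)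
      Finset.univ
    have h2 := pow_sum_mem_affineSpan_pow (LinearMap.snd (ZMod 2) F F) (fun i => m - s + i + j)
      (Finset.range s)
    rw [Finset.card_univ, Fintype.card_unit] at h1
    rw [Finset.card_range] at h2
    rw [add_comm, pow_add]
    convert Submodule.mul_mem_mul h1 h2 using 1
    ext w
    simp only [monoMap, hexp, mul_pow, ← pow_mul, Finset.sum_mul, Pi.mul_apply,
      LinearMap.fst_apply, LinearMap.snd_apply, Finset.univ_unique, Finset.sum_singleton, ← pow_add]
  have heq : (fun w : F × F => algebraMap (ZMod 2) F
      (Algebra.trace (ZMod 2) F (monoMap (2 ^ m) (2 ^ (m - s)) w))) =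
      ∑ j ∈ Finset.range m, fun w => monoMap (2 ^ m) (2 ^ (m - s)) w ^ 2 ^ j := by
    ext w
    rw [algebraMap_trace_zmod_two hF, Finset.sum_apply]
  rw [HasDegLE, heq]
  exact Submodule.sum_mem _ fun j _ => h j

theorem sum_pow_eq [DecidableEq F] {n : ℕ} (hn : n ≠ 0) :
    ∑ x : F, x ^ n = if Fintype.card F - 1 ∣ n then -1 else 0 := by
  rw [← FiniteField.sum_pow_units, ← Finset.add_sum_erase _ _ (Finset.mem_univ (0 : F)),
    zero_pow hn, zero_add]
  refine (Finset.sum_bij' (fun (u : Fˣ) _ => (u : F))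
    (fun x hx => Units.mk0 x (Finset.ne_of_mem_erase hx)) ?_ ?_ ?_ ?_ ?_).symm <;> simp

/-- The moment of `tr (X ^ e * Y ^ (q - e))` at the complementary monomial. -/
theorem sum_trace_monoMap_mul {m e N M : ℕ} (hF : Fintype.card F = 2 ^ m) (hm : m ≠ 0)
    (he0 : e ≠ 0) (he : e < 2 ^ m) (hcop : Nat.Coprime e (2 ^ m - 1)) (hN : 2 ^ m - 1 ∣ e + N)
    (hM : 2 ^ m - 1 ∣ 2 ^ m - e + M) :
    ∑ w : F × F, algebraMap (ZMod 2) F (Algebra.trace (ZMod 2) F (monoMap (2 ^ m) e w)) *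
      (w.1 ^ N * w.2 ^ M) = 1 := by
  classical
  have hterm (j : ℕ) : ∑ w : F × F, monoMap (2 ^ m) e w ^ 2 ^ j * (w.1 ^ N * w.2 ^ M) =
      (∑ x : F, x ^ (e * 2 ^ j + N)) * ∑ y : F, y ^ ((2 ^ m - e) * 2 ^ j + M) := by
    rw [Fintype.sum_prod_type, Finset.sum_mul_sum]
    refine Finset.sum_congr rfl fun x _ => Finset.sum_congr rfl fun y _ => ?_
    simp only [monoMap, mul_pow, ← pow_mul, pow_add]
    ring
  simp only [algebraMap_trace_zmod_two hF, Finset.sum_mul]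
  rw [Finset.sum_comm]
  simp only [hterm]
  -- A term survives only if q - 1 divides e2^j + N, hence e(2^j - 1), hence 2^j - 1, forcing j = 0.
  -- That term is (-1)(-1).
  rw [Finset.sum_eq_single 0]
  · rw [pow_zero, mul_one, mul_one, sum_pow_eq (by omega), sum_pow_eq (by omega), hF, if_pos hN,
      if_pos hM]
    ring
  · intro j hj hj0
    rw [Finset.mem_range] at hj
    have h1 : e * 2 ^ j + N ≠ 0 := by
      have : e * 2 ^ j ≠ 0 := by positivity
      omega
    rw [sum_pow_eq h1, hF, if_neg, zero_mul]
    intro h2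
    have h3 : 2 ^ m - 1 ∣ e * (2 ^ j - 1) := by
      have := Nat.dvd_sub h2 hN
      rwa [Nat.add_sub_add_right, ← Nat.mul_sub_one] at this
    have h4 := hcop.symm.dvd_of_dvd_mul_left h3
    have h5 : 2 ^ j < 2 ^ m := Nat.pow_lt_pow_right (by norm_num) hj
    have h6 : 1 < 2 ^ j := Nat.one_lt_two_pow hj0
    have := Nat.le_of_dvd (by omega) h4
    omega
  · intro h
    simp at h
    exact absurd h hm

/-- The binary digits absent from X's and Y's exponents give the complementary monomial, of degree
2m - (s + 1). -/
theorem exists_test_two_pow {m s : ℕ} (hF : Fintype.card F = 2 ^ m) (hs : s ≠ 0) (hsm : s < m) :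
    ∃ p ∈ affineSpan F (F × F) ^ (m - 1 + (m - s)), ∑ w : F × F, algebraMap (ZMod 2) F
      (Algebra.trace (ZMod 2) F (monoMap (2 ^ m) (2 ^ (m - s)) w)) * p w ≠ 0 := by
  have hmem : m - s ∈ Finset.range m := Finset.mem_range.2 (by omega)
  have h1 := pow_sum_mem_affineSpan_pow (LinearMap.fst (ZMod 2) F F) (fun i => i)
    ((Finset.range m).erase (m - s))
  have h2 := pow_sum_mem_affineSpan_pow (LinearMap.snd (ZMod 2) F F) (fun i => i)
    (Finset.range (m - s))
  rw [Finset.card_erase_of_mem hmem, Finset.card_range] at h1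
  rw [Finset.card_range] at h2
  have hlt : 2 ^ (m - s) < 2 ^ m := Nat.pow_lt_pow_right (by norm_num) (by omega)
  have hpos : 0 < 2 ^ (m - s) := by positivity
  refine ⟨_, by rw [pow_add]; exact Submodule.mul_mem_mul h1 h2, ?_⟩
  simp only [Pi.mul_apply, LinearMap.fst_apply, LinearMap.snd_apply]
  rw [sum_trace_monoMap_mul hF (by omega) hpos.ne' hlt]
  · exact one_ne_zero
  · apply Nat.Coprime.pow_left
    rw [Nat.coprime_two_left]
    exact Nat.Even.sub_odd Nat.one_le_two_pow (Nat.even_pow.2 ⟨even_two, by omega⟩) odd_one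
  · rw [Finset.add_sum_erase _ (fun i => 2 ^ i) hmem, Nat.geomSum_eq le_rfl, Nat.div_one]
  · rw [Nat.geomSum_eq le_rfl, Nat.div_one]
    exact dvd_of_eq (by omega)

theorem exists_test_invExp {m r : ℕ} (hF : Fintype.card F = 2 ^ m) (hm : 1 < m)
    (hrm : Nat.gcd r m = 1) (hcop : Nat.Coprime (invExp m r) (2 ^ m - 1)) :
    ∃ p ∈ affineSpan F (F × F) ^ m, ∑ w : F × F, algebraMap (ZMod 2) F
      (Algebra.trace (ZMod 2) F (monoMap (2 ^ m) (invExp m r) w)) * p w ≠ 0 := by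
  -- With rk ≡ 1 mod m and R = 2^r, R^k = 2 modulo q - 1. The sum of R^j over j < k is then 1/(R -
  -- 1) = -e, and the sum of R^(k+1+j) over j < m - k is -R/(R - 1) = e - 1. These complement e and
  -- q - e using only k + (m - k) = m powers of 2.
  obtain ⟨k, hk, hrk⟩ := Nat.exists_mul_mod_eq_one_of_coprime hrm hm
  have h1 := pow_sum_mem_affineSpan_pow (LinearMap.fst (ZMod 2) F F) (fun j => r * j)
    (Finset.range k)
  have h2 := pow_sum_mem_affineSpan_pow (LinearMap.snd (ZMod 2) F F) (fun j => r * (k + 1 + j))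
    (Finset.range (m - k))
  have hlt := invExp_lt m r (by omega)
  have h12 : 1 < 2 ^ m := Nat.one_lt_two_pow (by omega)
  have hne : NeZero (2 ^ m - 1) := ⟨by omega⟩
  have hε := invExp_spec m r hrm
  have hε' : ((invExp m r : ℕ) : ZMod (2 ^ m - 1)) = (1 - 2 ^ r : ZMod (2 ^ m - 1))⁻¹ := by
    rw [invExp, ZMod.natCast_zmod_val]
  rw [← hε'] at hε
  have h2m : (2 : ZMod (2 ^ m - 1)) ^ m = 1 := by
    have := ZMod.natCast_self (2 ^ m - 1)
    rw [Nat.cast_sub Nat.one_le_two_pow] at this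
    push_cast at this
    linear_combination this
  have h2k : ((2 : ZMod (2 ^ m - 1)) ^ r) ^ k = 2 := by
    rw [← pow_mul, ← Nat.div_add_mod (r * k) m, hrk, pow_add, pow_mul, h2m, one_pow, one_mul,
      pow_one]
  have h2mk : ((2 : ZMod (2 ^ m - 1)) ^ r) ^ k * (2 ^ r) ^ (m - k) = 1 := by
    rw [← pow_add, Nat.add_sub_cancel' hk.le, ← pow_mul, mul_comm, pow_mul, h2m, one_pow]
  rw [Finset.card_range] at h1 h2
  refine ⟨_, by
    rw [show m = k + (m - k) by omega, pow_add]
    exact Submodule.mul_mem_mul h1 h2, ?_⟩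
  simp only [Pi.mul_apply, LinearMap.fst_apply, LinearMap.snd_apply]
  rw [sum_trace_monoMap_mul hF (by omega) (invExp_ne_zero m r hrm hm) (by omega) hcop]
  · exact one_ne_zero
  · rw [← ZMod.natCast_eq_zero_iff]
    push_cast
    simp only [pow_mul]
    have hg := geom_sum_mul ((2 : ZMod (2 ^ m - 1)) ^ r) k
    rw [h2k] at hg
    generalize (∑ i ∈ Finset.range k, ((2 : ZMod (2 ^ m - 1)) ^ r) ^ i) = S at *
    generalize ((invExp m r : ℕ) : ZMod (2 ^ m - 1)) = ε at *
    linear_combination (-ε) * hg - S * hε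
  · rw [← ZMod.natCast_eq_zero_iff, Nat.cast_add, Nat.cast_sub (by omega)]
    push_cast
    simp only [pow_mul, pow_add, pow_one]
    rw [← Finset.mul_sum, h2k, h2m]
    have hg := geom_sum_mul ((2 : ZMod (2 ^ m - 1)) ^ r) (m - k)
    rw [h2k] at h2mk
    generalize (∑ i ∈ Finset.range (m - k), ((2 : ZMod (2 ^ m - 1)) ^ r) ^ i) = S at *
    generalize ((invExp m r : ℕ) : ZMod (2 ^ m - 1)) = ε at *
    generalize ((2 : ZMod (2 ^ m - 1)) ^ r) ^ (m - k) = P at *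
    generalize (2 : ZMod (2 ^ m - 1)) ^ r = R at *
    linear_combination (-(2 * R * S) - 1) * hε - 2 * R * ε * hg - R * ε * h2mk

end Test

/-! ### The three representatives and their inequivalence -/

section Main

variable {F K : Type*} [Field F] [Fintype F] [Field K] [Fintype K] [Algebra F K]
  [Algebra (ZMod 2) F] [Algebra (ZMod 2) K]

/-- Homogeneity extends the formula for g from the unit circle to all of K, giving both bentness and
the model. -/
theorem isAssociated_of_monoMap {m e : ℕ} (hF : Fintype.card F = 2 ^ m)
    (hK : Module.finrank F K = 2) {H : Set (ℙ F (Fin 3 → F))} {κ : (Fin 3 → F) ≃ₗ[F] (F × F) × F}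
    (hκ : IsGraph H κ (monoMap (2 ^ m) e)) (he0 : e ≠ 0) (he : e < 2 ^ m)
    (h0 : ∀ β : F, rootCount e 0 β = 1)
    (h1 : ∀ α β : F, α ≠ 0 → rootCount e α β = 0 ∨ rootCount e α β = 2)
    (E : K ≃ₗ[F] F × F) (B : K →ₗ[F] F) {f : K → ZMod 2} {g : unitCircle F K → F}
    (hfg : Corresponds F f g)
    (hg : ∀ u : unitCircle F K, g u = monoMap (2 ^ m) e (E u) + B u) :
    IsAssociated H f ∧
      IsModelledBy f (fun w : F × F => Algebra.trace (ZMod 2) F (monoMap (2 ^ m) e w)) := by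
  have : CharP F 2 := charP_two
  have hf (x : K) : f x = Algebra.trace (ZMod 2) F (monoMap (2 ^ m) e (E x) + B x) := by
    by_cases hx : x = 0
    · have h2 := hfg ⟨1, by simp [unitCircle, conj]⟩ 0
      rw [hx, map_zero, map_zero, monoMap_zero he0]
      simpa using h2
    · obtain ⟨c, u, -, rfl⟩ := exists_smul_unitCircle hK hx
      rw [hfg, hg, map_smul, map_smul, monoMap_smul hF he.le, smul_eq_mul, mul_add]
  refine ⟨⟨⟨isBent_of_monoMap hF he h0 h1 E B hf, fun u hu a b => ?_⟩, g, hfg,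
    projEquiv_of_isGraph hK hκ (fun c w => monoMap_smul hF he.le c w) E B hg⟩,
    E.symm.toAddEquiv, (Algebra.trace (ZMod 2) F).toAddMonoidHom.comp
      (B ∘ₗ E.symm.toLinearMap).toAddMonoidHom, fun w => ?_⟩
  · have h2 := hfg ⟨u, hu⟩
    simp only at h2
    rw [h2, h2, h2, add_mul, map_add]
  · have h2 := hf (E.symm w)
    rw [LinearEquiv.apply_symm_apply, map_add] at h2
    exact h2

theorem pow_two_pow_injective [CharP F 2] (s : ℕ) : Function.Injective fun x : F => x ^ 2 ^ s :=
  fun _ _ hxy => iterateFrobenius_inj F 2 s (by simpa [iterateFrobenius_def] using hxy)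

theorem fTrans_isAssociated {m s : ℕ} (hF : Fintype.card F = 2 ^ m)
    (hK : Module.finrank F K = 2) (hm : 1 < m) (hs : s ≠ 0) (hsm : s < m) (hgcd : Nat.gcd s m = 1)
    {a : K} (ha : a + conj F a = 1) {H : Set (ℙ F (Fin 3 → F))}
    {κ : (Fin 3 → F) ≃ₗ[F] (F × F) × F} (hκ : IsGraph H κ (monoMap (2 ^ m) (2 ^ (m - s)))) :
    IsAssociated H (fTrans m s a) ∧ IsModelledBy (fTrans m s a)
      (fun w : F × F => Algebra.trace (ZMod 2) F (monoMap (2 ^ m) (2 ^ (m - s)) w)) := by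
  have : CharP F 2 := charP_two
  have : CharP K 2 := charP_two
  have hgcd' : Nat.gcd (m - s) m = 1 := by
    rwa [Nat.gcd_self_sub_left hsm.le]
  exact isAssociated_of_monoMap hF hK hκ (by positivity)
    (Nat.pow_lt_pow_right (by norm_num) (by omega))
    (rootCount_zero (pow_two_pow_injective _))
    (fun α β hα => rootCount_two_pow hF (by omega) hgcd' hα β) (coords hK ha)
    (formLin F a + Algebra.trace F K (a ^ 2 ^ (m - s) * a) • formLin F 1)
    (corresponds_fTrans hF hK hm hs hsm.le ha) (fun u => gTrans_eq hF hK hs hsm.le ha u)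

theorem corresponds_thirdMap {m r : ℕ} (hF : Fintype.card F = 2 ^ m) (hm : 0 < m) (i : K) :
    Corresponds F (fun x => Algebra.trace (ZMod 2) F (thirdMap F m r i x))
      (fun u => thirdMap F m r i u) := by
  intro u c
  have he : invExp m r ≤ 2 ^ m := by have := invExp_lt m r hm; omega
  have h := monoMap_smul hF he c (form F i (u : K), form F 1 (u : K))
  show Algebra.trace (ZMod 2) F (thirdMap F m r i (c • (u : K))) = _
  congr 1
  rw [thirdMap, ← formLin_apply, ← formLin_apply, map_smul, map_smul]
  exact h

theorem thirdMap_isAssociated {m r : ℕ} (hF : Fintype.card F = 2 ^ m)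
    (hK : Module.finrank F K = 2) (hm : 1 < m) (hr : r ≠ 0) (hgcd : Nat.gcd r m = 1)
    {i : K} (hi : i + conj F i = 1) :
    IsAssociated (hyperovalD (fun t : F => t ^ 2 ^ r))
      (fun x => Algebra.trace (ZMod 2) F (thirdMap F m r i x)) ∧
    IsModelledBy (fun x => Algebra.trace (ZMod 2) F (thirdMap F m r i x))
      (fun w : F × F => Algebra.trace (ZMod 2) F (monoMap (2 ^ m) (invExp m r) w)) := by
  have : CharP F 2 := charP_two
  have : CharP K 2 := charP_two
  have he := invExp_lt m r (by omega)
  have he0 := invExp_ne_zero m r hgcd hm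
  refine isAssociated_of_monoMap hF hK (isGraph_coordsShift_zero hF hm hgcd) he0 (by omega)
    (rootCount_zero (pow_injective_of_coprime hF he0 (coprime_invExp hm hgcd)))
    (fun α β hα => rootCount_invExp hF hm hr hgcd hα β) (coords hK hi) 0
    (corresponds_thirdMap hF (by omega) i) (fun u => ?_)
  rw [LinearMap.zero_apply, add_zero]
  rfl

theorem not_eaEquiv_two_pow {m s s' : ℕ} (hF : Fintype.card F = 2 ^ m)
    (hss : s < s') (hs' : s' < m) {f f' : K → ZMod 2}
    (h : IsModelledBy f
      (fun w : F × F => Algebra.trace (ZMod 2) F (monoMap (2 ^ m) (2 ^ (m - s)) w)))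
    (h' : IsModelledBy f'
      (fun w : F × F => Algebra.trace (ZMod 2) F (monoMap (2 ^ m) (2 ^ (m - s')) w))) :
    ¬ EAEquiv f f' := by
  obtain ⟨p, hp, hsum⟩ := exists_test_two_pow hF (by omega : s' ≠ 0) hs'
  exact h.not_eaEquiv hF h' (hasDegLE_monoMap hF (by omega)) (by omega) hp (by omega) hsum

theorem not_eaEquiv_invExp {m r s : ℕ} (hF : Fintype.card F = 2 ^ m) (hm : 1 < m)
    (hrm : Nat.gcd r m = 1) (hs : s + 1 < m) {f f' : K → ZMod 2}
    (h : IsModelledBy f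
      (fun w : F × F => Algebra.trace (ZMod 2) F (monoMap (2 ^ m) (2 ^ (m - s)) w)))
    (h' : IsModelledBy f'
      (fun w : F × F => Algebra.trace (ZMod 2) F (monoMap (2 ^ m) (invExp m r) w))) :
    ¬ EAEquiv f f' := by
  obtain ⟨p, hp, hsum⟩ := exists_test_invExp hF hm hrm (coprime_invExp hm hrm)
  exact h.not_eaEquiv hF h' (hasDegLE_monoMap hF (by omega)) (by omega) hp (by omega) hsum

end Main

end Niho

theorem mainTheorem2 {F K : Type*} [Field F] [Fintype F] [Field K] [Fintype K] [Algebra F K]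
    [Algebra (ZMod 2) F] [Algebra (ZMod 2) K] (m r : ℕ)
    (hF : Fintype.card F = 2 ^ m) (hK : Module.finrank F K = 2)
    (hm : 5 ≤ m) (hr1 : 1 < r) (hr2 : r < m - 1) (hrm : Nat.gcd r m = 1)
    (a i : K) (ha : a + Niho.conj F a = 1) (hi : i + Niho.conj F i = 1) :
    let H : Set (Projectivization F (Fin 3 → F)) := Niho.hyperovalD (fun t => t ^ 2 ^ r)
    let f₁ : K → ZMod 2 := Niho.fTrans m r a
    let f₂ : K → ZMod 2 := Niho.fTrans m (m - r) a
    let f₃ : K → ZMod 2 := fun x => Algebra.trace (ZMod 2) F (Niho.thirdMap F m r i x)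
    let cls : (K → ZMod 2) → Quotient (Niho.eaSetoid K) := Quotient.mk (Niho.eaSetoid K)
    -- there are exactly three equivalence classes of associated Niho bent functions
    (cls '' {f | Niho.IsAssociated H f}).ncard = 3 ∧
    -- the three functions are associated with the hyperoval and represent these classes
    Niho.IsAssociated H f₁ ∧ Niho.IsAssociated H f₂ ∧ Niho.IsAssociated H f₃ ∧
    cls '' {f | Niho.IsAssociated H f} = {cls f₁, cls f₂, cls f₃} ∧
    -- the functions on the unit circle that correspond to them
    Niho.Corresponds F f₁ (Niho.gTrans F m r) ∧
    Niho.Corresponds F f₂ (Niho.gTrans F m (m - r)) ∧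
    Niho.Corresponds F f₃ (fun u => Niho.thirdMap F m r i u) := by
  intro H f₁ f₂ f₃ cls
  have : CharP F 2 := Niho.charP_two
  have hgcd : Nat.gcd (m - r) m = 1 := by
    rwa [Nat.gcd_self_sub_left (by omega)]
  have hmr : m - (m - r) = r := by omega
  obtain ⟨hA₁, hM₁⟩ := Niho.fTrans_isAssociated hF hK (by omega) (by omega) (by omega) hrm ha
    (Niho.isGraph_coordsYZ (r := r) hF (by omega) (by omega))
  obtain ⟨hA₂, hM₂⟩ := Niho.fTrans_isAssociated (s := m - r) hF hK (by omega) (by omega)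
    (by omega) hgcd ha (H := H)
    (by rw [hmr]; exact Niho.isGraph_coordsXZ (r := r) hF (by omega))
  obtain ⟨hA₃, hM₃⟩ := Niho.thirdMap_isAssociated (r := r) hF hK (by omega) (by omega) hrm hi
  have h12 : cls f₁ ≠ cls f₂ := by
    intro h
    -- If r = m - r then m = 2r, so gcd(r, m) = r > 1. The function with smaller degree goes first.
    rcases lt_or_gt_of_ne (show r ≠ m - r by
      intro h2
      rw [← h2, show m = r + r by omega] at hgcd
      simp at hgcd
      omega) with h2 | h2
    · exact Niho.not_eaEquiv_two_pow hF h2 (by omega) hM₁ hM₂ (Quotient.exact h)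
    · exact Niho.not_eaEquiv_two_pow hF h2 (by omega) hM₂ hM₁ (Quotient.exact h.symm)
  have h13 : cls f₁ ≠ cls f₃ := fun h =>
    Niho.not_eaEquiv_invExp hF (by omega) hrm (by omega) hM₁ hM₃ (Quotient.exact h)
  have h23 : cls f₂ ≠ cls f₃ := fun h =>
    Niho.not_eaEquiv_invExp hF (by omega) hrm (by omega) hM₂ hM₃ (Quotient.exact h)
  have hcls : cls '' {f | Niho.IsAssociated H f} = {cls f₁, cls f₂, cls f₃} := by
    apply Set.Subset.antisymm
    · rintro _ ⟨f, hf, rfl⟩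
      obtain ⟨e, he, hM⟩ :=
        Niho.exists_isModelledBy hF (by omega) (by omega) (by omega) hrm hf
      rcases he with rfl | rfl | rfl
      · rw [hmr] at hM₂
        exact Or.inr (Or.inl (Quotient.sound (hM.eaEquiv hM₂)))
      · exact Or.inl (Quotient.sound (hM.eaEquiv hM₁))
      · exact Or.inr (Or.inr (Quotient.sound (hM.eaEquiv hM₃)))
    · rintro _ (rfl | rfl | rfl)
      · exact ⟨_, hA₁, rfl⟩
      · exact ⟨_, hA₂, rfl⟩
      · exact ⟨_, hA₃, rfl⟩
  refine ⟨?_, hA₁, hA₂, hA₃, hcls,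
    Niho.corresponds_fTrans hF hK (by omega) (by omega) (by omega) ha,
    Niho.corresponds_fTrans hF hK (by omega) (by omega) (by omega) ha,
    Niho.corresponds_thirdMap hF (by omega) i⟩
  rw [hcls, Set.ncard_eq_three]
  exact ⟨_, _, _, h12, h13, h23, rfl⟩
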